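/- **Stages.** Let $\tau$ be a vocabulary and $\tau^+=\tau\cup\{\in\}$. Let $M$ be a finite $\tau$-structure, whose elements are regarded as urelements over which hereditarily finite sets are built. An inductive scheme $\Upsilon$ consists of first order formulas $\psi_\ell(x;\bar y_\ell)$ $(\ell<m_0)$ and $\varphi_\ell(x)$ $(\ell<m_1)$ in the vocabulary $\tau^+\cup\{P_\ell:\ell<m_1\}$, where the $P_\ell$ are new unary predicates. Put $N_0=M$ and $P_{0,\ell}=\emptyset$. For $N_t^+=(N_t,P_{t,0},\dots,P_{t,m_1-1})$ let $c_{t,\ell}=\{a\in N_t: N_t^+\models\varphi_\ell(a)\}$, $$N_{t+1}=N_t\cup\bigcup_{\ell<m_0}\bigl\{\{a\in N_t:N_t^+\models\psi_\ell(a,\bar b)\}:\bar b\in{}^{\mathrm{lg}(\bar y_\ell)}N_t\bigr\},\qquad P_{t+1,\ell}=\{c_{t,\ell}\}\cap N_{t+1},$$ and $N_\infty=\bigcup_{t<\infty} N_t$. In the $N_t$ a predicate of $\tau$ holds only of urelements, as in $M$. A function symbol $F$ of $\tau$ is interpreted as the partial function it is in $M$ and occurs in formulas only through its graph, i.e. in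 atomic formulas $F(x_1,\dots,x_n)=y$ with variables $x_i,y$ (constants are the case $n=0$). **Truth values.** Let $\mathbf t:\mathbb N\to\mathbb N\cup\{\infty\}$ and write $\mathbf t(M)=\mathbf t(\|M\|)$. The computation *halts* at $t$ if $m_1\ge 2$ and $c_{t,0}=c_{t,1}$; it *is out of time* at $t$ if $\|N_{t+1}\|+(t+1)>\mathbf t(M)$. The stopping time $t[M,\Upsilon,\mathbf t]\in\mathbb N\cup\{\infty\}$ is the least $t$ at which it halts or is out of time ($\infty$ if there is none). For a $\tau^+$-sentence $\chi$, the truth value of $\theta_{\Upsilon,\chi,\mathbf t}$ in $M$ is the truth value of $\chi$ in $N_t$ if $t=t[M,\Upsilon,\mathbf t]$ is finite and the computation halts at $t$; otherwise it is undefined. For $t\le\infty$ we say that $N_t[M,\Upsilon,\mathbf t]$ is well defined if the computation is not out of time at any stage $t'<t$; it is then $N_t$. **Systems.** For a family $I$ of sets let $I[m]$ be the family of unions of $m$ members of $I$. A *$k$-system* $\mathcal Y=(M,I,\mathcal F)$ consists of a finite $\tau$-structure $M$, a family $I$ of subsets of $M$ that is closed under subsets and contains all singletons, and a nonempty family $\mathcal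 F$ of partial automorphisms of $M$, closed under inverse, composition and restriction, such that: - if $f\in\mathcal F$, $A\in I$ and $A\subseteq\mathrm{Dom}(f)$, then $f''(A)\in I$; and $\mathrm{Dom}(f)\in I[k]$ for every $f\in\mathcal F$; - (D) if $f\in\mathcal F$, $A\in I[k-1]$, $A\subseteq \mathrm{Dom}(f)$ and $B\in I$, then there is $g\in\mathcal F$ with $f\restriction A\subseteq g$ and $B\subseteq\mathrm{Dom}(g)$. For $h:[m]\to M$ let $H_h=\{f\circ h:f\in\mathcal F,\ \mathrm{Rang}(h)\subseteq\mathrm{Dom}(f)\}$. An equivalence relation $E$ on $H_h$ is *invariant* if $h_1Eh_2\Leftrightarrow h_3Eh_4$ whenever $h_1,\dots,h_4\in H_h$ and some $f\in\mathcal F$ with $\mathrm{Rang}(h_1)\cup\mathrm{Rang}(h_2)\subseteq\mathrm{Dom}(f)$ satisfies $f\circ h_1=h_3$, $f\circ h_2=h_4$. Consider the alternatives - $(\beta)_1$ (with $u\subseteq[m]$): $\mathrm{Rang}(h\restriction u)\in I$, and $h_1\restriction u=h_2\restriction u\Rightarrow h_1Eh_2$ for all $h_1,h_2\in H_h$; -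 $(\beta)_2$: $E$ has more than $\mathbf t(M)$ equivalence classes. A *$(\mathbf t,k,s)$-system* is a $k$-system such that (E) for every $m$, every $h:[m]\to M$ with $\mathrm{Rang}(h)\in I[s]$ and every invariant equivalence relation $E$ on $H_h$, either $(\beta)_1$ holds for some $u$ or $(\beta)_2$ holds. **Witnesses.** Let $\mathcal Y_\ell=(M_\ell,I_\ell,\mathcal F_\ell)$ be a $(\mathbf t_\ell,k,s)$-system for $\ell=1,2$. A *$(k,s)$-witness to the equivalence of $(\mathcal Y_1,\mathbf t_1)$ and $(\mathcal Y_2,\mathbf t_2)$* is a nonempty family $\mathcal H$ of partial isomorphisms from $M_1$ to $M_2$ such that: 1. for $g\in\mathcal H$: $\mathrm{Dom}(g)\in I_1[k]$ and $\mathrm{Rang}(g)\in I_2[k]$; $g\circ f_1\in\mathcal H$ for $f_1\in\mathcal F_1$ and $f_2\circ g\in\mathcal H$ for $f_2\in\mathcal F_2$; 2. for $g\in\mathcal H$, $A\in I_1[k-1]$, $B\in I_1$ there is $g_1\in\mathcal H$ with $g\restriction A\subseteq g_1$ and $B\subseteq\mathrm{Dom}(g_1)$; for $g\in\mathcal H$,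 $A\in I_2[k-1]$, $B\in I_2$ there is $g_1\in\mathcal H$ with $g^{-1}\restriction A\subseteq g_1^{-1}$ and $B\subseteq\mathrm{Rang}(g_1)$; 3. $\mathcal H$ preserves the alternative chosen in (E): let $g\in\mathcal H$, $h:[m]\to M_1$ with $\mathrm{Rang}(h)\subseteq\mathrm{Dom}(g)$ and $\mathrm{Rang}(h)\in I_1[s]$, and let $E$ be an invariant equivalence relation on $H_h$. Then the image $\mathcal H(E)=\{(g'\circ h_1,g'\circ h_2):h_1Eh_2,\ g'\in\mathcal H,\ \mathrm{Rang}(h_1)\cup\mathrm{Rang}(h_2)\subseteq\mathrm{Dom}(g')\}$ is an invariant equivalence relation on $H_{g\circ h}$ (with respect to $\mathcal Y_2$), and either there is one $u$ such that $(\beta)_1$ holds with this $u$ both for $(h,E)$ in $\mathcal Y_1$ and for $(g\circ h,\mathcal H(E))$ in $\mathcal Y_2$, or $(\beta)_2$ holds for both (with $\mathbf t_1$ and $\mathbf t_2$ respectively). The same holds for $\{g^{-1}:g\in\mathcal H\}$ with the two systems exchanged. **Theorem.** Let $\mathcal Y_1,\mathcal Y_2$ be $(\mathbf t_1,k,s)$-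 and $(\mathbf t_2,k,s)$-systems over the same vocabulary $\tau$, and let $\mathcal H$ be a $(k,s)$-witness to the equivalence of $(\mathcal Y_1,\mathbf t_1)$ and $(\mathcal Y_2,\mathbf t_2)$. Let $\Upsilon$ be an inductive scheme that is not too complicated relative to $(k,s)$: $3\le k$, $3s\le k$, $\mathrm{lg}(\bar y_\ell)\le s$ for all $\ell$, and every subformula of a formula $\psi_\ell$ or $\varphi_\ell$ of $\Upsilon$ has at most $k$ free variables. Then: ($\alpha$) For every $\tau^+$-sentence $\chi$ all of whose subformulas have at most $k$ free variables, the truth value of $\theta_{\Upsilon,\chi,\mathbf t_1}$ in $M_1$ equals that of $\theta_{\Upsilon,\chi,\mathbf t_2}$ in $M_2$ (possibly both undefined), except possibly when for some $\ell\in\{1,2\}$ the truth value of $\theta_{\Upsilon,\chi,\mathbf t_\ell}$ in $M_\ell$ is undefined, that of $\theta_{\Upsilon,\chi,\mathbf t_{3-\ell}}$ in $M_{3-\ell}$ is defined, and $t[M_\ell,\Upsilon,\mathbf t_\ell]<t[M_{3-\ell},\Upsilon,\mathbf t_{3-\ell}]$. ($\beta$) For every $t\in\mathbb N\cup\{\infty\}$,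 if $N^\ell=N_t[M_\ell,\Upsilon,\mathbf t_\ell]$ is well defined for $\ell=1,2$, then $N^1\models\chi\Leftrightarrow N^2\models\chi$ for every $\tau^+$-sentence $\chi$ all of whose subformulas have at most $k$ free variables. -/

import Mathlib

universe u v w w'

noncomputable section

/-! Hereditarily finite sets over a type `M` of urelements. -/

/-- Codes for hereditarily finite sets with urelements from `M`. -/
inductive PreHF (M : Type w) : Type w
  | atom (a : M) : PreHF M
  | mk (n : ℕ) (A : Fin n → PreHF M) : PreHF M

namespace PreHF

variable {M : Type w}

/-- Two codes denote the same object: equal urelements, or sets with the same elements. -/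
def Equiv : PreHF M → PreHF M → Prop
  | atom a, atom b => a = b
  | atom _, mk _ _ => False
  | mk _ _, atom _ => False
  | mk _ A, mk _ B => (∀ i, ∃ j, Equiv (A i) (B j)) ∧ (∀ j, ∃ i, Equiv (A i) (B j))

theorem Equiv.refl : ∀ x : PreHF M, Equiv x x
  | atom _ => by simp [Equiv]
  | mk _ A => by
      simp only [Equiv]
      exact ⟨fun i => ⟨i, Equiv.refl (A i)⟩, fun i => ⟨i, Equiv.refl (A i)⟩⟩

theorem Equiv.symm : ∀ {x y : PreHF M}, Equiv x y → Equiv y x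
  | atom _, atom _, h => by
      simp only [Equiv] at h ⊢
      exact h.symm
  | atom _, mk _ _, h => by simp [Equiv] at h
  | mk _ _, atom _, h => by simp [Equiv] at h
  | mk _ A, mk _ B, h => by
      simp only [Equiv] at h ⊢
      refine ⟨fun j => ?_, fun i => ?_⟩
      · obtain ⟨i, hi⟩ := h.2 j
        exact ⟨i, Equiv.symm hi⟩
      · obtain ⟨j, hj⟩ := h.1 i
        exact ⟨j, Equiv.symm hj⟩

theorem Equiv.trans : ∀ {x y z : PreHF M}, Equiv x y → Equiv y z → Equiv x z
  | atom _, atom _, atom _, h, k => by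
      simp only [Equiv] at h k ⊢
      exact Eq.trans h k
  | atom _, mk _ _, _, h, _ => by simp [Equiv] at h
  | mk _ _, atom _, _, h, _ => by simp [Equiv] at h
  | _, atom _, mk _ _, _, k => by simp [Equiv] at k
  | _, mk _ _, atom _, _, k => by simp [Equiv] at k
  | mk _ A, mk _ B, mk _ C, h, k => by
      simp only [Equiv] at h k ⊢
      refine ⟨fun i => ?_, fun l => ?_⟩
      · obtain ⟨j, hj⟩ := h.1 i
        obtain ⟨l, hl⟩ := k.1 j
        exact ⟨l, Equiv.trans hj hl⟩
      · obtain ⟨j, hj⟩ := k.2 l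
        obtain ⟨i, hi⟩ := h.2 j
        exact ⟨i, Equiv.trans hi hj⟩

instance setoid (M : Type w) : Setoid (PreHF M) :=
  ⟨Equiv, Equiv.refl, Equiv.symm, Equiv.trans⟩

/-- `Elem x y`: the object coded by `y` is a set, and that coded by `x` is one of its elements. -/
def Elem (x : PreHF M) : PreHF M → Prop
  | atom _ => False
  | mk _ A => ∃ i, Equiv x (A i)

/-- The code denotes a set (and not a urelement). -/
def IsSet : PreHF M → Prop
  | atom _ => False
  | mk _ _ => True

theorem elem_congr {x x' y y' : PreHF M} (hx : Equiv x x') (hy : Equiv y y') :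
    Elem x y ↔ Elem x' y' := by
  cases y <;> cases y' <;> simp only [Equiv, Elem] at hy ⊢
  constructor
  · rintro ⟨i, hi⟩
    obtain ⟨j, hj⟩ := hy.1 i
    exact ⟨j, hx.symm.trans (hi.trans hj)⟩
  · rintro ⟨j, hj⟩
    obtain ⟨i, hi⟩ := hy.2 j
    exact ⟨i, hx.trans (hj.trans hi.symm)⟩

theorem isSet_congr {x y : PreHF M} (h : Equiv x y) : IsSet x ↔ IsSet y := by
  cases x <;> cases y <;> simp only [Equiv, IsSet] at h ⊢

end PreHF

/-- The hereditarily finite sets over the urelements `M` (including the urelements). -/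
def HF (M : Type w) : Type w := Quotient (PreHF.setoid M)

namespace HF

variable {M : Type w}

/-- The elements of `M`, as urelements. -/
def atom (a : M) : HF M := Quotient.mk _ (PreHF.atom a)

/-- Being a set, as opposed to a urelement. -/
def IsSet (x : HF M) : Prop :=
  Quotient.liftOn x PreHF.IsSet fun _ _ h => propext (PreHF.isSet_congr h)

/-- The membership relation; urelements have no elements. -/
def Elem (x y : HF M) : Prop :=
  Quotient.liftOn₂ x y PreHF.Elem fun _ _ _ _ h k => propext (PreHF.elem_congr h k)

/-- `x` is the set whose elements are exactly the members of the collection `S`. -/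
def IsSetOf (S : Set (HF M)) (x : HF M) : Prop :=
  IsSet x ∧ ∀ y, Elem y x ↔ y ∈ S

theorem atom_injective : Function.Injective (atom : M → HF M) := by
  intro a b h
  have h' : PreHF.Equiv (PreHF.atom a) (PreHF.atom b) := Quotient.exact h
  simpa only [PreHF.Equiv] using h'

theorem not_isSet_atom (a : M) : ¬ IsSet (atom a) := fun h => h

theorem isSet_or_atom (x : HF M) : IsSet x ∨ ∃ a, x = atom a := by
  induction x using Quotient.inductionOn with
  | h x =>
    cases x with
    | atom a => exact Or.inr ⟨a, rfl⟩
    | mk n A => exact Or.inl trivial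

/-- Extensionality. -/
theorem IsSetOf.unique {S : Set (HF M)} {x y : HF M} (hx : IsSetOf S x) (hy : IsSetOf S y) :
    x = y := by
  obtain ⟨hx, hx'⟩ := hx
  obtain ⟨hy, hy'⟩ := hy
  have key : ∀ z, Elem z x ↔ Elem z y := fun z => (hx' z).trans (hy' z).symm
  clear hx' hy'
  induction x, y using Quotient.inductionOn₂ with
  | h x y =>
    cases x with
    | atom a => exact hx.elim
    | mk n A =>
      cases y with
      | atom a => exact hy.elim
      | mk m B =>
        apply Quotient.sound
        change PreHF.Equiv _ _
        simp only [PreHF.Equiv]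
        refine ⟨fun i => ?_, fun j => ?_⟩
        · exact (key (Quotient.mk _ (A i))).1 ⟨i, PreHF.Equiv.refl _⟩
        · obtain ⟨i, hi⟩ := (key (Quotient.mk _ (B j))).2 ⟨j, PreHF.Equiv.refl _⟩
          exact ⟨i, hi.symm⟩

/-- Every finite collection of objects is a set. -/
theorem exists_isSetOf {S : Set (HF M)} (hS : S.Finite) : ∃ x, IsSetOf S x := by
  obtain ⟨n, f, hf⟩ := hS.fin_param
  refine ⟨Quotient.mk _ (PreHF.mk n fun i => (f i).out), trivial, fun y => ?_⟩
  rw [← hf.2]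
  constructor
  · intro h
    induction y using Quotient.inductionOn with
    | h y =>
      obtain ⟨i, hi⟩ := h
      refine ⟨i, ?_⟩
      rw [← Quotient.out_eq (f i)]
      exact Quotient.sound hi.symm
  · rintro ⟨i, rfl⟩
    conv => arg 1; rw [← Quotient.out_eq (f i)]
    exact ⟨i, PreHF.Equiv.refl _⟩

end HF

/-! Vocabularies with membership, and inductive schemes. -/

/-- The predicates of the vocabulary `τ ∪ {∈} ∪ {P_i : i < m}`. As the function symbols and
constants of `τ` are only partially defined once sets are present, a function symbol enters through
its graph `F x₁ … xₙ = y`. -/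
inductive ExtRel (L : FirstOrder.Language.{u, v}) (m : ℕ) : ℕ → Type (max u v)
  | rel {n : ℕ} (R : L.Relations n) : ExtRel L m n
  | graph {n : ℕ} (F : L.Functions n) : ExtRel L m (n + 1)
  | mem : ExtRel L m 2
  | pred (i : Fin m) : ExtRel L m 1

/-- The vocabulary `τ ∪ {∈} ∪ {P_i : i < m}`; for `m = 0` it is `τ⁺ = τ ∪ {∈}`. -/
def extLang (L : FirstOrder.Language.{u, v}) (m : ℕ) : FirstOrder.Language.{0, max u v} :=
  ⟨fun _ => Empty, ExtRel L m⟩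

/-- The variables, free or currently bound, that occur in a term. -/
def termVars {L : FirstOrder.Language.{u, v}} {β : Type w} : L.Term β → Set β
  | .var b => {b}
  | .func _ ts => ⋃ i, termVars (ts i)

/-- The free variables of a formula; for a formula taken from inside a larger one, they include
the variables `Fin n` that are bound further outside. -/
def freeVars {L : FirstOrder.Language.{u, v}} {β : Type w} :
    {n : ℕ} → L.BoundedFormula β n → Set (β ⊕ Fin n)
  | _, .falsum => ∅
  | _, .equal t₁ t₂ => termVars t₁ ∪ termVars t₂
  | _, .rel _ ts => ⋃ i, termVars (ts i)
  | _, .imp φ ψ => freeVars φ ∪ freeVars ψ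
  | _, .all φ => {z | Sum.map id Fin.castSucc z ∈ freeVars φ}

/-- Every subformula has at most `k` free variables. -/
def SubformulasAtMost {L : FirstOrder.Language.{u, v}} {β : Type w} (k : ℕ) :
    {n : ℕ} → L.BoundedFormula β n → Prop
  | _, .falsum => True
  | _, .equal t₁ t₂ => (freeVars (.equal t₁ t₂)).encard ≤ k
  | _, .rel R ts => (freeVars (.rel R ts)).encard ≤ k
  | _, .imp φ ψ =>
      (freeVars (.imp φ ψ)).encard ≤ k ∧ SubformulasAtMost k φ ∧ SubformulasAtMost k ψ
  | _, .all φ => (freeVars (.all φ)).encard ≤ k ∧ SubformulasAtMost k φ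

/-- An inductive scheme over the vocabulary `L`: set-forming formulas `ψ_ℓ(x; ȳ_ℓ)`, `ℓ < m₀`
(`none` is `x`, and `some j` is the `j`-th entry of `ȳ_ℓ`) and formulas `φ_ℓ(x)`, `ℓ < m₁`, all of
them first order in `L ∪ {∈} ∪ {P_ℓ : ℓ < m₁}`. -/
structure InductiveScheme (L : FirstOrder.Language.{u, v}) where
  m₀ : ℕ
  m₁ : ℕ
  arity : Fin m₀ → ℕ
  psi : (ℓ : Fin m₀) → (extLang L m₁).Formula (Option (Fin (arity ℓ)))
  phi : Fin m₁ → (extLang L m₁).Formula Unit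

/-- The scheme is not too complicated relative to `(k, s)`. -/
structure InductiveScheme.NotTooComplicated {L : FirstOrder.Language.{u, v}} (U : InductiveScheme L)
    (k s : ℕ) : Prop where
  three_le : 3 ≤ k
  three_mul_le : 3 * s ≤ k
  arity_le : ∀ ℓ, U.arity ℓ ≤ s
  psi_vars : ∀ ℓ, SubformulasAtMost k (U.psi ℓ)
  phi_vars : ∀ ℓ, SubformulasAtMost k (U.phi ℓ)

/-! The stages of the computation. -/

/-- A collection of objects over `M` together with `m` unary predicates. -/
structure Stage (M : Type w) (m : ℕ) where
  univ : Set (HF M)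
  pred : Fin m → Set (HF M)

namespace Stage

variable (L : FirstOrder.Language.{u, v}) {M : Type w} [L.Structure M] {m : ℕ}

/-- The interpretation of the predicates of `extLang L m` in a stage. -/
def Holds (S : Stage M m) : {n : ℕ} → ExtRel L m n → (Fin n → S.univ) → Prop
  | _, .rel R, x =>
      ∃ a : Fin _ → M, (∀ i, (x i : HF M) = HF.atom (a i)) ∧ FirstOrder.Language.Structure.RelMap R a
  | _, .graph (n := n) F, x =>
      ∃ a : Fin (n + 1) → M, (∀ i, (x i : HF M) = HF.atom (a i)) ∧
        FirstOrder.Language.Structure.funMap F (fun i : Fin n => a i.castSucc) = a (Fin.last n)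
  | _, .mem, x => HF.Elem (x 0 : HF M) (x 1)
  | _, .pred i, x => (x 0 : HF M) ∈ S.pred i

/-- A stage as a first order structure. -/
@[reducible] def str (S : Stage M m) : (extLang L m).Structure S.univ where
  funMap := fun f _ => Empty.elim f
  RelMap := fun R x => S.Holds L R x

/-- First order satisfaction in a stage. -/
def Sat (S : Stage M m) {β : Type w'} (φ : (extLang L m).Formula β) (x : β → S.univ) : Prop :=
  @FirstOrder.Language.Formula.Realize (extLang L m) S.univ (S.str L) β φ x

/-- The subset `{a : ψ(a, b̄)}` of a stage. -/
def definedSet (S : Stage M m) {β : Type w'} (ψ : (extLang L m).Formula (Option β))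
    (b : β → S.univ) : Set (HF M) :=
  {a | ∃ ha : a ∈ S.univ, S.Sat L ψ fun o => o.elim ⟨a, ha⟩ b}

end Stage

namespace InductiveScheme

variable {L : FirstOrder.Language.{u, v}} (U : InductiveScheme L) (M : Type w) [L.Structure M]

/-- The family of the sets `{a ∈ N : ψ_ℓ(a, b̄)}`, with `b̄` ranging over the tuples from `N`. -/
def family (S : Stage M U.m₁) (ℓ : Fin U.m₀) : Set (HF M) :=
  {x | ∃ b : Fin (U.arity ℓ) → S.univ, HF.IsSetOf (S.definedSet L (U.psi ℓ) b) x}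

/-- The set `c_ℓ = {a ∈ N : φ_ℓ(a)}`. -/
def update (S : Stage M U.m₁) (ℓ : Fin U.m₁) : Set (HF M) :=
  {a | ∃ ha : a ∈ S.univ, S.Sat L (U.phi ℓ) fun _ => ⟨a, ha⟩}

/-- The expanded stages `N_t⁺[M] = (N_t[M], P_{t,0}, …)`: `P_{0,ℓ}` is empty, and `P_{t+1,ℓ}` holds
of `c_{t,ℓ}` only (of nothing if `c_{t,ℓ}` is not an element of `N_{t+1}[M]`). -/
def stage : ℕ → Stage M U.m₁
  | 0 => ⟨Set.range HF.atom, fun _ => ∅⟩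
  | t + 1 =>
      { univ := (stage t).univ ∪ (⋃ ℓ, U.family M (stage t) ℓ)
        pred := fun ℓ => {x | x ∈ (stage t).univ ∪ (⋃ ℓ', U.family M (stage t) ℓ') ∧
          HF.IsSetOf (U.update M (stage t) ℓ) x} }

/-- The universe of `N_t[M]`, where `N_∞[M]` is the union of the `N_t[M]`. -/
def carrier (t : ℕ∞) : Set (HF M) :=
  ⋃ (n : ℕ) (_ : (n : ℕ∞) ≤ t), (U.stage M n).univ

/-- `N_t[M] ⊨ χ`, for a sentence `χ` in the vocabulary `τ⁺`. -/
def StageSat (t : ℕ∞) (χ : (extLang L 0).Sentence) : Prop :=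
  (Stage.mk (m := 0) (U.carrier M t) (fun i => i.elim0)).Sat L χ Empty.elim

/-- The next stage does not fit into the time bound: `‖N_{t+1}[M]‖ + (t + 1) > T(‖M‖)`. -/
def OutOfTime (T : ℕ → ℕ∞) (t : ℕ) : Prop :=
  T (Nat.card M) < (U.stage M (t + 1)).univ.encard + (t + 1)

/-- The halting condition `c_{t,0} = c_{t,1}`. -/
def Halts (t : ℕ) : Prop :=
  ∃ h : 2 ≤ U.m₁, U.update M (U.stage M t) ⟨0, by omega⟩ = U.update M (U.stage M t) ⟨1, by omega⟩

/-- The stopping time: the first `t` at which the computation halts or runs out of time. -/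
def stopTime (T : ℕ → ℕ∞) : ℕ∞ :=
  sInf {t : ℕ∞ | ∃ n : ℕ, t = n ∧ (U.OutOfTime M T n ∨ U.Halts M n)}

open Classical in
/-- The truth value of `θ_{U,χ,T}` in `M`: that of `χ` in `N_t[M]` if the computation halts at its
stopping time `t`; undefined (`none`) if it is stopped by the time bound, or never. -/
def truthValue (χ : (extLang L 0).Sentence) (T : ℕ → ℕ∞) : Option Prop :=
  if U.stopTime M T ≠ ⊤ ∧ U.Halts M (U.stopTime M T).toNat then
    some (U.StageSat M (U.stopTime M T) χ)
  else none

/-- `N_t[M]` is well defined for the time bound `T`: time does not run out before stage `t`. -/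
def StageDefined (T : ℕ → ℕ∞) (t : ℕ∞) : Prop :=
  ∀ n : ℕ, (n : ℕ∞) < t → ¬ U.OutOfTime M T n

end InductiveScheme

/-! Partial isomorphisms. -/

namespace PEquiv

variable {M : Type w} {N : Type w'}

/-- The domain of a partial bijection. -/
def dom (f : M ≃. N) : Set M := {a | ∃ b, b ∈ f a}

/-- The range of a partial bijection. -/
def rng (f : M ≃. N) : Set N := {b | ∃ a, b ∈ f a}

/-- The image `f''(A)`. -/
def img (f : M ≃. N) (A : Set M) : Set N := {b | ∃ a ∈ A, b ∈ f a}

open Classical in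
/-- The restriction of a partial bijection to a set. -/
def restr (f : M ≃. N) (A : Set M) : M ≃. N := (PEquiv.ofSet A).trans f

/-- `h' = f ∘ h`, and the range of `h` is contained in the domain of `f`. -/
def Carries (f : M ≃. N) {m : ℕ} (h : Fin m → M) (h' : Fin m → N) : Prop :=
  ∀ i, h' i ∈ f (h i)

/-- Partial isomorphisms of `L`-structures. -/
structure IsPartialIso (L : FirstOrder.Language.{u, v}) [L.Structure M] [L.Structure N] (f : M ≃. N) :
    Prop where
  rel : ∀ {n : ℕ} (R : L.Relations n) (a : Fin n → M) (b : Fin n → N), f.Carries a b →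
    (FirstOrder.Language.Structure.RelMap R a ↔ FirstOrder.Language.Structure.RelMap R b)
  func : ∀ {n : ℕ} (F : L.Functions n) (a : Fin n → M) (b : Fin n → N) (x : M) (y : N),
    f.Carries a b → y ∈ f x →
    (FirstOrder.Language.Structure.funMap F a = x ↔ FirstOrder.Language.Structure.funMap F b = y)

end PEquiv

/-! Systems of supports and partial automorphisms. -/

/-- The data `(I, ℱ)` of a system `(M, I, ℱ)`. -/
structure SupportData (M : Type w) where
  I : Set (Set M)
  F : Set (M ≃. M)

/-- `I[m]`: the unions of `m` members of `I`. -/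
def unionsOf {M : Type w} (I : Set (Set M)) (m : ℕ) : Set (Set M) :=
  {A | ∃ B : Fin m → Set M, (∀ i, B i ∈ I) ∧ A = ⋃ i, B i}

/-- `(M, I, ℱ)` is a `k`-system. -/
structure IsKSystem (L : FirstOrder.Language.{u, v}) {M : Type w} [L.Structure M] (k : ℕ)
    (Y : SupportData M) : Prop where
  subset_mem : ∀ A ∈ Y.I, ∀ B, B ⊆ A → B ∈ Y.I
  singleton_mem : ∀ a : M, {a} ∈ Y.I
  nonempty : Y.F.Nonempty
  partialAut : ∀ f ∈ Y.F, f.IsPartialIso L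
  img_mem : ∀ f ∈ Y.F, ∀ A ∈ Y.I, A ⊆ f.dom → f.img A ∈ Y.I
  symm_mem : ∀ f ∈ Y.F, f.symm ∈ Y.F
  trans_mem : ∀ f ∈ Y.F, ∀ g ∈ Y.F, f.trans g ∈ Y.F
  restr_mem : ∀ f ∈ Y.F, ∀ A, f.restr A ∈ Y.F
  dom_mem : ∀ f ∈ Y.F, f.dom ∈ unionsOf Y.I k
  extend : ∀ f ∈ Y.F, ∀ A ∈ unionsOf Y.I (k - 1), A ⊆ f.dom → ∀ B ∈ Y.I,
    ∃ g ∈ Y.F, f.restr A ≤ g ∧ B ⊆ g.dom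

namespace SupportData

variable {M : Type w} (Y : SupportData M) {m : ℕ}

/-- `H_h`: the functions `f ∘ h` with `f ∈ ℱ` and `Rang(h) ⊆ Dom(f)`. -/
def orbit (h : Fin m → M) : Set (Fin m → M) := {h' | ∃ f ∈ Y.F, f.Carries h h'}

/-- `E` is an `ℱ`-invariant equivalence relation on `H_h`. -/
structure IsInvEquiv (h : Fin m → M) (E : (Fin m → M) → (Fin m → M) → Prop) : Prop where
  mem : ∀ h₁ h₂, E h₁ h₂ → h₁ ∈ Y.orbit h ∧ h₂ ∈ Y.orbit h
  refl : ∀ h₁ ∈ Y.orbit h, E h₁ h₁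
  symm : ∀ h₁ h₂, E h₁ h₂ → E h₂ h₁
  trans : ∀ h₁ h₂ h₃, E h₁ h₂ → E h₂ h₃ → E h₁ h₃
  inv : ∀ h₁ ∈ Y.orbit h, ∀ h₂ ∈ Y.orbit h, ∀ h₃ ∈ Y.orbit h, ∀ h₄ ∈ Y.orbit h,
    ∀ f ∈ Y.F, f.Carries h₁ h₃ → f.Carries h₂ h₄ → (E h₁ h₂ ↔ E h₃ h₄)

/-- First alternative of the dichotomy: `h` restricted to `u` has range in `I` and determines the
class of `h` modulo `E`. -/
def SmallSupport (h : Fin m → M) (E : (Fin m → M) → (Fin m → M) → Prop) (u : Set (Fin m)) : Prop :=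
  h '' u ∈ Y.I ∧ ∀ h₁ ∈ Y.orbit h, ∀ h₂ ∈ Y.orbit h, Set.EqOn h₁ h₂ u → E h₁ h₂

/-- Second alternative of the dichotomy: `E` has more than `T(‖M‖)` equivalence classes. -/
def ManyClasses (T : ℕ → ℕ∞) (h : Fin m → M) (E : (Fin m → M) → (Fin m → M) → Prop) : Prop :=
  T (Nat.card M) < ((fun h₁ => {h₂ | E h₁ h₂}) '' Y.orbit h).encard

/-- The system is `(T, s)`-dichotomical. -/
def IsDichotomical (T : ℕ → ℕ∞) (s : ℕ) : Prop :=
  ∀ (m : ℕ) (h : Fin m → M) (E : (Fin m → M) → (Fin m → M) → Prop),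
    Set.range h ∈ unionsOf Y.I s → Y.IsInvEquiv h E →
    (∃ u, Y.SmallSupport h E u) ∨ Y.ManyClasses T h E

end SupportData

/-- `(M, I, ℱ)` is a `(T, k, s)`-system. -/
structure IsSystem (L : FirstOrder.Language.{u, v}) {M : Type w} [L.Structure M] (T : ℕ → ℕ∞) (k s : ℕ)
    (Y : SupportData M) : Prop where
  kSystem : IsKSystem L k Y
  dichotomical : Y.IsDichotomical T s

section Witness

variable {M₁ : Type w} {M₂ : Type w'}

/-- `H` is a `k`-witness to the equivalence of two `k`-systems. -/
structure IsKWitness (L : FirstOrder.Language.{u, v}) [L.Structure M₁] [L.Structure M₂] (k : ℕ)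
    (Y₁ : SupportData M₁) (Y₂ : SupportData M₂) (H : Set (M₁ ≃. M₂)) : Prop where
  kSystem₁ : IsKSystem L k Y₁
  kSystem₂ : IsKSystem L k Y₂
  nonempty : H.Nonempty
  partialIso : ∀ g ∈ H, g.IsPartialIso L
  dom_mem : ∀ g ∈ H, g.dom ∈ unionsOf Y₁.I k
  rng_mem : ∀ g ∈ H, g.rng ∈ unionsOf Y₂.I k
  comp_left : ∀ g ∈ H, ∀ f ∈ Y₁.F, f.trans g ∈ H
  comp_right : ∀ g ∈ H, ∀ f ∈ Y₂.F, g.trans f ∈ H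
  forth : ∀ g ∈ H, ∀ A ∈ unionsOf Y₁.I (k - 1), ∀ B ∈ Y₁.I,
    ∃ g' ∈ H, g.restr A ≤ g' ∧ B ⊆ g'.dom
  back : ∀ g ∈ H, ∀ A ∈ unionsOf Y₂.I (k - 1), ∀ B ∈ Y₂.I,
    ∃ g' ∈ H, g.symm.restr A ≤ g'.symm ∧ B ⊆ g'.rng

/-- The image of a relation `E` under the maps in `H`. -/
def transport (H : Set (M₁ ≃. M₂)) {m : ℕ} (E : (Fin m → M₁) → (Fin m → M₁) → Prop) :
    (Fin m → M₂) → (Fin m → M₂) → Prop :=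
  fun p q => ∃ g ∈ H, ∃ h₁ h₂, E h₁ h₂ ∧ g.Carries h₁ p ∧ g.Carries h₂ q

/-- The maps in `H` preserve the alternative chosen in the dichotomy: if `g ∈ H` carries `h` to
`h'`, then an invariant equivalence relation `E` on `H_h` is carried to an invariant equivalence
relation on `H_{h'}`, and the same alternative (with the same `u`) can be chosen for both. -/
def PreservesDichotomy (T₁ T₂ : ℕ → ℕ∞) (s : ℕ) (Y₁ : SupportData M₁) (Y₂ : SupportData M₂)
    (H : Set (M₁ ≃. M₂)) : Prop :=
  ∀ g ∈ H, ∀ (m : ℕ) (h : Fin m → M₁) (h' : Fin m → M₂) (E : (Fin m → M₁) → (Fin m → M₁) → Prop),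
    g.Carries h h' → Set.range h ∈ unionsOf Y₁.I s → Y₁.IsInvEquiv h E →
    Y₂.IsInvEquiv h' (transport H E) ∧
    ((∃ u, Y₁.SmallSupport h E u ∧ Y₂.SmallSupport h' (transport H E) u) ∨
      (Y₁.ManyClasses T₁ h E ∧ Y₂.ManyClasses T₂ h' (transport H E)))

/-- `H` is a `(k, s)`-witness to the equivalence of `(Y₁, T₁)` and `(Y₂, T₂)`. -/
structure IsWitness (L : FirstOrder.Language.{u, v}) [L.Structure M₁] [L.Structure M₂] (T₁ T₂ : ℕ → ℕ∞)
    (k s : ℕ) (Y₁ : SupportData M₁) (Y₂ : SupportData M₂) (H : Set (M₁ ≃. M₂)) : Prop where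
  system₁ : IsSystem L T₁ k s Y₁
  system₂ : IsSystem L T₂ k s Y₂
  kWitness : IsKWitness L k Y₁ Y₂ H
  preserves : PreservesDichotomy T₁ T₂ s Y₁ Y₂ H
  preserves_symm : PreservesDichotomy T₂ T₁ s Y₂ Y₁ (PEquiv.symm '' H)

end Witness

end

/-! The maps in `H` move urelements only; they act on an object of a stage once that object has a
support, a tuple `h` with range in `I` such that a map defined on `h` determines an image of the
object. `Matched` expresses this by recursion on the stage: two sets with supports `h` and `h'`
correspond if every map in `H` carrying `h` to `h'` respects membership for the objects linked at
the preceding stage. As a support lies in `I`, up to `k` objects are supported by a member of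
`I[k]`, and the extension property of `H` supplies the moves of a `k`-pebble game
(`BackForth.realize_iff`). Since `k ≥ 3`, images are unique (`BiTotal.right_unique`), so that
equality and membership are preserved. What remains is that supports exist (`Total`, `BiTotal`).

Existence goes by induction on the stage, and this is where the dichotomy enters. A new object is
`{a : ψ(a, b)}` with at most `s` parameters, whose supports join to a tuple `h` with range in
`I[s]`, in general too large to be a support. Call two tuples in `H_h` equivalent if the parameters
transported to them define the same set (`SameValue`). By the game this relation is invariant.
Different classes give different elements of `N_{t+1}`, so a computation that is not out of time at
`t` excludes more than `T(‖M‖)` classes. Hence some restriction of `h` with range in `I` already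
determines the defined set, and this restriction is the support (`JointTotal.of_value`). Because `H`
preserves the alternative together with `u`, the same restriction works for the maps in `H`. The
relation lives on the first system while its image is taken along `H`, so supports must serve `ℱ₁`
and `H` at once (`JointTotal`), and correspondences along `ℱ₁` and along `H` must compose
(`Matched.trans`).

Hence, as long as neither computation has run out of time, the stages satisfy the same sentences,
and halting, an equality of two definable sets, happens simultaneously. If the stopping times
differ, the computation that stops first can only have run out of time. -/

namespace PEquiv

variable {M : Type w} {N : Type w'}

/-! ### Partial bijections acting on tuples. -/

theorem mem_restr {f : M ≃. N} {A : Set M} {a : M} {b : N} :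
    b ∈ f.restr A a ↔ a ∈ A ∧ b ∈ f a := by
  classical
  simp only [restr, PEquiv.mem_trans, PEquiv.mem_ofSet_iff]
  constructor
  · rintro ⟨c, ⟨rfl, hc⟩, h⟩
    exact ⟨hc, h⟩
  · rintro ⟨ha, h⟩
    exact ⟨a, ⟨rfl, ha⟩, h⟩

theorem restr_le_iff {f g : M ≃. N} {A : Set M} :
    f.restr A ≤ g ↔ ∀ a ∈ A, ∀ b ∈ f a, b ∈ g a := by
  rw [PEquiv.le_def]
  simp only [mem_restr]
  exact ⟨fun h a ha b hb => h a b ⟨ha, hb⟩, fun h a b hab => h a hab.1 b hab.2⟩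

theorem rng_eq_dom_symm (f : M ≃. N) : f.rng = f.symm.dom := by
  ext b
  exact exists_congr fun a => (PEquiv.mem_iff_mem f).symm

theorem dom_eq_rng_symm (f : M ≃. N) : f.dom = f.symm.rng := by
  rw [rng_eq_dom_symm, PEquiv.symm_symm]

theorem IsPartialIso.symm {L : FirstOrder.Language.{u, v}} [L.Structure M] [L.Structure N]
    {f : M ≃. N} (hf : f.IsPartialIso L) : f.symm.IsPartialIso L where
  rel R a b h := (hf.rel R b a fun i => (PEquiv.mem_iff_mem f).1 (h i)).symm
  func F a b x y h hx :=
    (hf.func F b a y x (fun i => (PEquiv.mem_iff_mem f).1 (h i)) ((PEquiv.mem_iff_mem f).1 hx)).symm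

theorem carries_symm {f : M ≃. N} {m : ℕ} {h : Fin m → M} {h' : Fin m → N} :
    f.symm.Carries h' h ↔ f.Carries h h' :=
  forall_congr' fun _ => PEquiv.mem_iff_mem f

theorem Carries.trans {P : Type*} {f : M ≃. N} {g : N ≃. P} {m : ℕ} {h : Fin m → M}
    {h' : Fin m → N} {h'' : Fin m → P} (hf : f.Carries h h') (hg : g.Carries h' h'') :
    (f.trans g).Carries h h'' := fun i => (PEquiv.mem_trans f g _ _).2 ⟨h' i, hf i, hg i⟩

theorem Carries.comp {f : M ≃. N} {m n : ℕ} {h : Fin m → M} {h' : Fin m → N}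
    (hf : f.Carries h h') (e : Fin n → Fin m) : f.Carries (h ∘ e) (h' ∘ e) := fun i => hf (e i)

theorem Carries.range_subset_dom {f : M ≃. N} {m : ℕ} {h : Fin m → M} {h' : Fin m → N}
    (hf : f.Carries h h') : Set.range h ⊆ f.dom := by
  rintro _ ⟨i, rfl⟩
  exact ⟨_, hf i⟩

theorem exists_carries {f : M ≃. N} {m : ℕ} {h : Fin m → M} (hf : Set.range h ⊆ f.dom) :
    ∃ h' : Fin m → N, f.Carries h h' := by
  have : ∀ i, ∃ b, b ∈ f (h i) := fun i => hf ⟨i, rfl⟩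
  choose h' hh' using this
  exact ⟨h', hh'⟩

theorem Carries.img_range {f : M ≃. N} {m : ℕ} {h : Fin m → M} {h' : Fin m → N}
    (hf : f.Carries h h') : f.img (Set.range h) = Set.range h' := by
  ext b
  constructor
  · rintro ⟨_, ⟨i, rfl⟩, hb⟩
    exact ⟨i, Option.mem_unique (hf i) hb⟩
  · rintro ⟨i, rfl⟩
    exact ⟨_, ⟨i, rfl⟩, hf i⟩

theorem Carries.ext {f : M ≃. N} {m : ℕ} {h : Fin m → M} {h' h'' : Fin m → N}
    (hf : f.Carries h h') (hf' : f.Carries h h'') : h' = h'' :=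
  funext fun i => Option.mem_unique (hf i) (hf' i)

end PEquiv

/-! ### Unions of members of the ideal `I`. -/

section Unions

variable {M : Type w} {I : Set (Set M)}

theorem mem_unionsOf_one {A : Set M} (hA : A ∈ I) : A ∈ unionsOf I 1 :=
  ⟨fun _ => A, fun _ => hA, (Set.iUnion_const A).symm⟩

theorem empty_mem_unionsOf_zero : (∅ : Set M) ∈ unionsOf I 0 :=
  ⟨fun i => i.elim0, fun i => i.elim0, by simp⟩

theorem union_mem_unionsOf {i j : ℕ} {A B : Set M} (hA : A ∈ unionsOf I i)
    (hB : B ∈ unionsOf I j) : A ∪ B ∈ unionsOf I (i + j) := by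
  obtain ⟨C, hC, rfl⟩ := hA
  obtain ⟨D, hD, rfl⟩ := hB
  refine ⟨Fin.append C D, fun l => ?_, ?_⟩
  · refine Fin.addCases (fun l => ?_) (fun l => ?_) l
    · rw [Fin.append_left]; exact hC l
    · rw [Fin.append_right]; exact hD l
  · ext a
    simp only [Set.mem_union, Set.mem_iUnion]
    constructor
    · rintro (⟨l, hl⟩ | ⟨l, hl⟩)
      · exact ⟨Fin.castAdd j l, by rwa [Fin.append_left]⟩
      · exact ⟨Fin.natAdd i l, by rwa [Fin.append_right]⟩
    · rintro ⟨l, hl⟩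
      induction l using Fin.addCases with
      | left l => rw [Fin.append_left] at hl; exact Or.inl ⟨l, hl⟩
      | right l => rw [Fin.append_right] at hl; exact Or.inr ⟨l, hl⟩

theorem empty_mem_unionsOf (h : ∅ ∈ I) (j : ℕ) : (∅ : Set M) ∈ unionsOf I j :=
  ⟨fun _ => ∅, fun _ => h, by simp⟩

theorem unionsOf_mono (h : ∅ ∈ I) {i j : ℕ} (hij : i ≤ j) : unionsOf I i ⊆ unionsOf I j := by
  intro A hA
  have := union_mem_unionsOf hA (empty_mem_unionsOf h (j - i))
  rwa [Set.union_empty, Nat.add_sub_cancel' hij] at this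

theorem unionsOf_subset (h : ∀ A ∈ I, ∀ B, B ⊆ A → B ∈ I) {i : ℕ} {A B : Set M}
    (hA : A ∈ unionsOf I i) (hB : B ⊆ A) : B ∈ unionsOf I i := by
  obtain ⟨C, hC, rfl⟩ := hA
  refine ⟨fun l => C l ∩ B, fun l => h _ (hC l) _ Set.inter_subset_left, ?_⟩
  rw [← Set.iUnion_inter, Set.inter_eq_right.2 hB]

theorem biUnion_mem_unionsOf (h : ∅ ∈ I) {ι : Type*} (S : Finset ι) {j : ℕ} (hS : S.card ≤ j)
    {A : ι → Set M} (hA : ∀ z ∈ S, A z ∈ I) : (⋃ z ∈ S, A z) ∈ unionsOf I j := by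
  classical
  refine unionsOf_mono h hS ?_
  clear hS
  induction S using Finset.induction_on with
  | empty => simpa using empty_mem_unionsOf_zero
  | insert a S ha ih =>
    rw [Finset.card_insert_of_notMem ha, Finset.set_biUnion_insert, add_comm]
    exact union_mem_unionsOf (mem_unionsOf_one (hA a (Finset.mem_insert_self a S)))
      (ih fun z hz => hA z (Finset.mem_insert_of_mem hz))

end Unions

/-! ### Extension properties of systems and witnesses. -/

section Systems

variable {L : FirstOrder.Language.{u, v}} {M₁ : Type w} {M₂ : Type w'} [L.Structure M₁]
  [L.Structure M₂] {k : ℕ} {Y₁ : SupportData M₁} {Y₂ : SupportData M₂} {H : Set (M₁ ≃. M₂)}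

theorem IsKSystem.empty_mem (hY : IsKSystem L k Y₁) (hk : 0 < k) : ∅ ∈ Y₁.I := by
  obtain ⟨f, hf⟩ := hY.nonempty
  obtain ⟨B, hB, -⟩ := hY.dom_mem f hf
  exact hY.subset_mem _ (hB ⟨0, hk⟩) _ (Set.empty_subset _)

theorem IsKSystem.range_mem (hY : IsKSystem L k Y₁) {f : M₁ ≃. M₁} (hf : f ∈ Y₁.F) {m : ℕ}
    {h h' : Fin m → M₁} (hc : f.Carries h h') (hh : Set.range h ∈ Y₁.I) :
    Set.range h' ∈ Y₁.I := by
  rw [← hc.img_range]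
  exact hY.img_mem f hf _ hh hc.range_subset_dom

/-- A `k`-system is equivalent to itself. -/
theorem IsKSystem.isKWitness (hY : IsKSystem L k Y₁) : IsKWitness L k Y₁ Y₁ Y₁.F := by
  have forth : ∀ g ∈ Y₁.F, ∀ A ∈ unionsOf Y₁.I (k - 1), ∀ B ∈ Y₁.I,
      ∃ g' ∈ Y₁.F, g.restr A ≤ g' ∧ B ⊆ g'.dom := by
    intro g hg A hA B hB
    -- Condition (D) requires `A ⊆ Dom(f)`, the witness clause does not; points outside the domain
    -- carry no values to be kept.
    obtain ⟨g', hg', h, hd⟩ := hY.extend g hg (A ∩ g.dom)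
      (unionsOf_subset hY.subset_mem hA Set.inter_subset_left) Set.inter_subset_right B hB
    refine ⟨g', hg', ?_, hd⟩
    rw [PEquiv.restr_le_iff] at h ⊢
    exact fun a ha b hb => h a ⟨ha, b, hb⟩ b hb
  refine ⟨hY, hY, hY.nonempty, hY.partialAut, hY.dom_mem, fun g hg => ?_,
    fun g hg f hf => hY.trans_mem f hf g hg, fun g hg f hf => hY.trans_mem g hg f hf, forth, ?_⟩
  · rw [PEquiv.rng_eq_dom_symm]
    exact hY.dom_mem _ (hY.symm_mem g hg)
  · intro g hg A hA B hB
    obtain ⟨g', hg', h, hd⟩ := forth g.symm (hY.symm_mem g hg) A hA B hB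
    refine ⟨g'.symm, hY.symm_mem g' hg', by rwa [PEquiv.symm_symm], ?_⟩
    rwa [← PEquiv.dom_eq_rng_symm]

theorem IsKSystem.symm_image (hY : IsKSystem L k Y₁) : PEquiv.symm '' Y₁.F = Y₁.F := by
  ext f
  constructor
  · rintro ⟨g, hg, rfl⟩
    exact hY.symm_mem g hg
  · exact fun hf => ⟨f.symm, hY.symm_mem f hf, PEquiv.symm_symm f⟩

namespace IsKWitness

variable (W : IsKWitness L k Y₁ Y₂ H)

include W

theorem symm : IsKWitness L k Y₂ Y₁ (PEquiv.symm '' H) where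
  kSystem₁ := W.kSystem₂
  kSystem₂ := W.kSystem₁
  nonempty := W.nonempty.image _
  partialIso := by
    rintro _ ⟨g, hg, rfl⟩
    exact (W.partialIso g hg).symm
  dom_mem := by
    rintro _ ⟨g, hg, rfl⟩
    rw [← PEquiv.rng_eq_dom_symm]
    exact W.rng_mem g hg
  rng_mem := by
    rintro _ ⟨g, hg, rfl⟩
    rw [← PEquiv.dom_eq_rng_symm]
    exact W.dom_mem g hg
  comp_left := by
    rintro _ ⟨g, hg, rfl⟩ f hf
    exact ⟨g.trans f.symm, W.comp_right g hg _ (W.kSystem₂.symm_mem f hf), by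
      rw [PEquiv.symm_trans_rev, PEquiv.symm_symm]⟩
  comp_right := by
    rintro _ ⟨g, hg, rfl⟩ f hf
    exact ⟨f.symm.trans g, W.comp_left g hg _ (W.kSystem₁.symm_mem f hf), by
      rw [PEquiv.symm_trans_rev, PEquiv.symm_symm]⟩
  forth := by
    rintro _ ⟨g, hg, rfl⟩ A hA B hB
    obtain ⟨g', hg', h, hd⟩ := W.back g hg A hA B hB
    exact ⟨g'.symm, ⟨g', hg', rfl⟩, h, by rwa [← PEquiv.rng_eq_dom_symm]⟩
  back := by
    rintro _ ⟨g, hg, rfl⟩ A hA B hB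
    obtain ⟨g', hg', h, hd⟩ := W.forth g hg A hA B hB
    exact ⟨g'.symm, ⟨g', hg', rfl⟩, by simpa only [PEquiv.symm_symm] using h,
      by rwa [← PEquiv.dom_eq_rng_symm]⟩

/-- The `i` pieces of `C` are added one at a time. Before each step the part to be kept is a union
of at most `k - 1` members of `I`, which is all that the forth clause can keep. -/
theorem exists_extension (hk : 0 < k) {i j : ℕ} (hij : i + j ≤ k) {g : M₁ ≃. M₂} (hg : g ∈ H)
    {A C : Set M₁} (hA : A ∈ unionsOf Y₁.I j) (hC : C ∈ unionsOf Y₁.I i) :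
    ∃ g' ∈ H, g.restr A ≤ g' ∧ C ⊆ g'.dom := by
  have h0 := W.kSystem₁.empty_mem hk
  obtain ⟨B, hB, rfl⟩ := hC
  induction i with
  | zero =>
    refine ⟨g, hg, ?_, by simp⟩
    rw [PEquiv.restr_le_iff]
    exact fun _ _ _ => id
  | succ i ih =>
    obtain ⟨g₁, hg₁, h₁, hd₁⟩ := ih (by omega) (fun l => B l.castSucc) (fun l => hB _)
    have hmem : A ∪ ⋃ l : Fin i, B l.castSucc ∈ unionsOf Y₁.I (k - 1) :=
      unionsOf_mono h0 (by omega : j + i ≤ k - 1)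
        (union_mem_unionsOf hA ⟨fun l => B l.castSucc, fun l => hB _, rfl⟩)
    obtain ⟨g₂, hg₂, h₂, hd₂⟩ := W.forth g₁ hg₁ _ hmem _ (hB (Fin.last i))
    rw [PEquiv.restr_le_iff] at h₁ h₂
    refine ⟨g₂, hg₂, ?_, ?_⟩
    · rw [PEquiv.restr_le_iff]
      exact fun a ha b hb => h₂ a (Or.inl ha) b (h₁ a ha b hb)
    · intro a ha
      obtain ⟨l, hl⟩ := Set.mem_iUnion.1 ha
      induction l using Fin.lastCases with
      | last => exact hd₂ hl
      | cast l =>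
        have hl' : a ∈ ⋃ l : Fin i, B l.castSucc := Set.mem_iUnion.2 ⟨l, hl⟩
        obtain ⟨b, hb⟩ := hd₁ hl'
        exact ⟨b, h₂ a (Or.inr hl') b hb⟩

/-- A map in `H` can be changed so as to be defined on a given tuple, while it keeps its values
on a given set. -/
theorem exists_carries (hk : 0 < k) {i j : ℕ} (hij : i + j ≤ k) {g : M₁ ≃. M₂} (hg : g ∈ H)
    {A : Set M₁} (hA : A ∈ unionsOf Y₁.I j) {n : ℕ} {c : Fin n → M₁}
    (hc : Set.range c ∈ unionsOf Y₁.I i) :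
    ∃ g' ∈ H, ∃ c', g'.Carries c c' ∧ ∀ {m : ℕ} (h : Fin m → M₁) (h' : Fin m → M₂),
      Set.range h ⊆ A → g.Carries h h' → g'.Carries h h' := by
  obtain ⟨g', hg', hr, hd⟩ := W.exists_extension hk hij hg hA hc
  obtain ⟨c', hc'⟩ := PEquiv.exists_carries hd
  rw [PEquiv.restr_le_iff] at hr
  exact ⟨g', hg', c', hc', fun h h' hA hh i => hr _ (hA ⟨i, rfl⟩) _ (hh i)⟩

theorem exists_carries_back (hk : 0 < k) {i j : ℕ} (hij : i + j ≤ k) {g : M₁ ≃. M₂} (hg : g ∈ H)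
    {A : Set M₂} (hA : A ∈ unionsOf Y₂.I j) {n : ℕ} {c' : Fin n → M₂}
    (hc : Set.range c' ∈ unionsOf Y₂.I i) :
    ∃ g' ∈ H, ∃ c, g'.Carries c c' ∧ ∀ {m : ℕ} (h : Fin m → M₁) (h' : Fin m → M₂),
      Set.range h' ⊆ A → g.Carries h h' → g'.Carries h h' := by
  obtain ⟨_, ⟨g', hg', rfl⟩, c, hc, h⟩ := W.symm.exists_carries hk hij ⟨g, hg, rfl⟩ hA hc
  exact ⟨g', hg', c, PEquiv.carries_symm.1 hc, fun a b hb hab =>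
    PEquiv.carries_symm.1 (h b a hb (PEquiv.carries_symm.2 hab))⟩

end IsKWitness

end Systems

/-! ### Growth and finiteness of the stages. -/

section Stages

variable {L : FirstOrder.Language.{u, v}} (U : InductiveScheme L) (M : Type w) [L.Structure M]

theorem HF.not_elem_atom (a : M) (z : HF M) : ¬ HF.Elem z (HF.atom a) := by
  induction z using Quotient.inductionOn with
  | h z => exact fun h => h

theorem HF.ext_of_elem {M : Type w} {x y : HF M} (hx : x.IsSet) (hy : y.IsSet)
    (h : ∀ z, HF.Elem z x ↔ HF.Elem z y) : x = y :=
  HF.IsSetOf.unique (S := {z | HF.Elem z y}) ⟨hx, h⟩ ⟨hy, fun _ => Iff.rfl⟩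

namespace InductiveScheme

theorem stage_subset_succ (t : ℕ) : (U.stage M t).univ ⊆ (U.stage M (t + 1)).univ :=
  Set.subset_union_left

theorem stage_mono {i j : ℕ} (h : i ≤ j) : (U.stage M i).univ ⊆ (U.stage M j).univ :=
  monotone_nat_of_le_succ (f := fun t => (U.stage M t).univ) (U.stage_subset_succ M) h

theorem atom_mem_stage (t : ℕ) (a : M) : HF.atom a ∈ (U.stage M t).univ :=
  U.stage_mono M (Nat.zero_le t) ⟨a, rfl⟩

theorem definedSet_subset {m : ℕ} (S : Stage M m) {β : Type*}
    (ψ : (extLang L m).Formula (Option β)) (b : β → S.univ) : S.definedSet L ψ b ⊆ S.univ :=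
  fun _ ha => ha.1

/-- Each new set is a subset of the stage that defines it, so membership in objects of `N_{t+1}` can
be tested inside `N_t`. -/
theorem elem_mem_stage_of_succ (t : ℕ) : ∀ {x z : HF M}, x ∈ (U.stage M (t + 1)).univ →
    HF.Elem z x → z ∈ (U.stage M t).univ := by
  induction t with
  | zero =>
    rintro x z (⟨a, rfl⟩ | hx) hz
    · exact (HF.not_elem_atom M a z hz).elim
    · obtain ⟨ℓ, b, hb⟩ := Set.mem_iUnion.1 hx
      exact definedSet_subset M _ _ _ ((hb.2 z).1 hz)
  | succ t ih =>
    rintro x z (hx | hx) hz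
    · exact U.stage_subset_succ M t (ih hx hz)
    · obtain ⟨ℓ, b, hb⟩ := Set.mem_iUnion.1 hx
      exact definedSet_subset M _ _ _ ((hb.2 z).1 hz)

theorem finite_stage [Finite M] (t : ℕ) : (U.stage M t).univ.Finite := by
  induction t with
  | zero => exact Set.finite_range _
  | succ t ih =>
    refine ih.union (Set.finite_iUnion fun ℓ => ?_)
    have : Finite (U.stage M t).univ := ih
    choose f hf using fun b : Fin (U.arity ℓ) → (U.stage M t).univ =>
      HF.exists_isSetOf (ih.subset (definedSet_subset M _ (U.psi ℓ) b))
    refine (Set.finite_range f).subset ?_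
    rintro x ⟨b, hb⟩
    exact ⟨b, (hf b).unique hb⟩

theorem isSetOf_mem_stage_succ {t : ℕ} {ℓ : Fin U.m₀} {b : Fin (U.arity ℓ) → (U.stage M t).univ}
    {x : HF M} (hx : HF.IsSetOf ((U.stage M t).definedSet L (U.psi ℓ) b) x) :
    x ∈ (U.stage M (t + 1)).univ :=
  Or.inr (Set.mem_iUnion.2 ⟨ℓ, b, hx⟩)

end InductiveScheme

end Stages

/-! ### The pebble game on supported objects. -/

section BackAndForth

variable {L : FirstOrder.Language.{u, v}} {M₁ : Type w} {M₂ : Type w'} [L.Structure M₁]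
  [L.Structure M₂] {k m : ℕ} {Y₁ : SupportData M₁} {Y₂ : SupportData M₂} {H : Set (M₁ ≃. M₂)}

/-- Relations between objects over two structures, relative to tuples of urelements that
support the objects. -/
abbrev SupportedRel (M₁ : Type w) (M₂ : Type w') :=
  ∀ n : ℕ, (Fin n → M₁) → (Fin n → M₂) → HF M₁ → HF M₂ → Prop

/-- The map `g` carries supports witnessing that `x` and `y` are related. -/
def Linked (R : SupportedRel M₁ M₂) (g : M₁ ≃. M₂) (x : HF M₁) (y : HF M₂) : Prop :=
  ∃ (n : ℕ) (h : Fin n → M₁) (h' : Fin n → M₂), g.Carries h h' ∧ R n h h' x y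

variable (L) in
/-- The relation `R` gives winning positions for the duplicator in the pebble game on the
stages `S₁` and `S₂`. -/
structure BackForth (Y₁ : SupportData M₁) (Y₂ : SupportData M₂) (H : Set (M₁ ≃. M₂))
    (S₁ : Stage M₁ m) (S₂ : Stage M₂ m) (R : SupportedRel M₁ M₂) : Prop where
  range₁ : ∀ {n : ℕ} {h : Fin n → M₁} {h' : Fin n → M₂} {x y}, R n h h' x y → Set.range h ∈ Y₁.I
  range₂ : ∀ {n : ℕ} {h : Fin n → M₁} {h' : Fin n → M₂} {x y}, R n h h' x y → Set.range h' ∈ Y₂.I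
  mem₁ : ∀ {n : ℕ} {h : Fin n → M₁} {h' : Fin n → M₂} {x y}, R n h h' x y → x ∈ S₁.univ
  mem₂ : ∀ {n : ℕ} {h : Fin n → M₁} {h' : Fin n → M₂} {x y}, R n h h' x y → y ∈ S₂.univ
  forth : ∀ x ∈ S₁.univ, ∃ (n : ℕ) (h : Fin n → M₁), Set.range h ∈ Y₁.I ∧
    ∀ g ∈ H, ∀ h', g.Carries h h' → ∃ y, R n h h' x y
  back : ∀ y ∈ S₂.univ, ∃ (n : ℕ) (h' : Fin n → M₂), Set.range h' ∈ Y₂.I ∧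
    ∀ g ∈ H, ∀ h, g.Carries h h' → ∃ x, R n h h' x y
  eq : ∀ g ∈ H, ∀ {x y z w}, Linked R g x y → Linked R g z w → (x = z ↔ y = w)
  holds : ∀ g ∈ H, ∀ {n : ℕ} (r : ExtRel L m n) (x : Fin n → S₁.univ) (y : Fin n → S₂.univ),
    (∀ i, Linked R g (x i) (y i)) → (S₁.Holds L r x ↔ S₂.Holds L r y)

namespace BackForth

variable {S₁ : Stage M₁ m} {S₂ : Stage M₂ m} {R : SupportedRel M₁ M₂}
  (B : BackForth L Y₁ Y₂ H S₁ S₂ R) (W : IsKWitness L k Y₁ Y₂ H)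

include B W

/-- A move of the game: the supports of the pebbled objects form a member of `I[S.card]`, one more
support is needed for `x`, and `S.card + 1 ≤ k` leaves room for it. -/
theorem exists_linked (hk : 0 < k) {ι : Type*} {S : Finset ι} (hS : S.card + 1 ≤ k)
    {g : M₁ ≃. M₂} (hg : g ∈ H) {p : ι → HF M₁} {q : ι → HF M₂}
    (hpq : ∀ i ∈ S, Linked R g (p i) (q i)) {x : HF M₁} (hx : x ∈ S₁.univ) :
    ∃ g' ∈ H, ∃ y ∈ S₂.univ, Linked R g' x y ∧ ∀ i ∈ S, Linked R g' (p i) (q i) := by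
  have h0 := W.kSystem₁.empty_mem hk
  obtain ⟨n, c, hc, hcR⟩ := B.forth x hx
  choose d a a' ha haR using fun i : S => hpq i i.2
  obtain ⟨g', hg', c', hcc', hkeep⟩ := W.exists_carries hk (by omega : 1 + S.card ≤ k) hg
    (biUnion_mem_unionsOf h0 (Finset.univ : Finset S) (by simp) fun i _ => B.range₁ (haR i)) (mem_unionsOf_one hc)
  obtain ⟨y, hy⟩ := hcR g' hg' c' hcc'
  exact ⟨g', hg', y, B.mem₂ hy, ⟨n, c, c', hcc', hy⟩, fun i hi => ⟨d ⟨i, hi⟩, a ⟨i, hi⟩, a' ⟨i, hi⟩,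
    hkeep _ _ (Set.subset_biUnion_of_mem (u := fun i : S => Set.range (a i))
      (Finset.mem_univ (⟨i, hi⟩ : S))) (ha ⟨i, hi⟩), haR ⟨i, hi⟩⟩⟩

theorem exists_linked_back (hk : 0 < k) {ι : Type*} {S : Finset ι} (hS : S.card + 1 ≤ k)
    {g : M₁ ≃. M₂} (hg : g ∈ H) {p : ι → HF M₁} {q : ι → HF M₂}
    (hpq : ∀ i ∈ S, Linked R g (p i) (q i)) {y : HF M₂} (hy : y ∈ S₂.univ) :
    ∃ g' ∈ H, ∃ x ∈ S₁.univ, Linked R g' x y ∧ ∀ i ∈ S, Linked R g' (p i) (q i) := by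
  have h0 := W.kSystem₂.empty_mem hk
  obtain ⟨n, c', hc, hcR⟩ := B.back y hy
  choose d a a' ha haR using fun i : S => hpq i i.2
  obtain ⟨g', hg', c, hcc', hkeep⟩ := W.exists_carries_back hk (by omega : 1 + S.card ≤ k) hg
    (biUnion_mem_unionsOf h0 (Finset.univ : Finset S) (by simp) fun i _ => B.range₂ (haR i)) (mem_unionsOf_one hc)
  obtain ⟨x, hx⟩ := hcR g' hg' c hcc'
  exact ⟨g', hg', x, B.mem₁ hx, ⟨n, c, c', hcc', hx⟩, fun i hi => ⟨d ⟨i, hi⟩, a ⟨i, hi⟩, a' ⟨i, hi⟩,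
    hkeep _ _ (Set.subset_biUnion_of_mem (u := fun i : S => Set.range (a' i))
      (Finset.mem_univ (⟨i, hi⟩ : S))) (ha ⟨i, hi⟩), haR ⟨i, hi⟩⟩⟩

/-- Properties of a single object that agree on linked pairs hold for all objects of one stage
if and only if they hold for all objects of the other. -/
theorem forall_iff (hk : 0 < k) {ι : Type*} {S : Finset ι} (hS : S.card + 1 ≤ k)
    {g : M₁ ≃. M₂} (hg : g ∈ H) {p : ι → HF M₁} {q : ι → HF M₂}
    (hpq : ∀ i ∈ S, Linked R g (p i) (q i)) {P : S₁.univ → Prop} {Q : S₂.univ → Prop}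
    (hPQ : ∀ g' ∈ H, (∀ i ∈ S, Linked R g' (p i) (q i)) → ∀ (x : S₁.univ) (y : S₂.univ),
      Linked R g' x y → (P x ↔ Q y)) :
    (∀ x, P x) ↔ ∀ y, Q y := by
  constructor
  · rintro h ⟨y, hy⟩
    obtain ⟨g', hg', x, hx, hxy, hl⟩ := B.exists_linked_back W hk hS hg hpq hy
    exact (hPQ g' hg' hl ⟨x, hx⟩ ⟨y, hy⟩ hxy).1 (h _)
  · rintro h ⟨x, hx⟩
    obtain ⟨g', hg', y, hy, hxy, hl⟩ := B.exists_linked W hk hS hg hpq hx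
    exact (hPQ g' hg' hl ⟨x, hx⟩ ⟨y, hy⟩ hxy).2 (h _)

end BackForth

theorem encard_freeVars_le {L' : FirstOrder.Language.{u, v}} {β : Type*} {n : ℕ}
    {φ : L'.BoundedFormula β n} (h : SubformulasAtMost k φ) : (freeVars φ).encard ≤ k := by
  cases φ with
  | falsum => simp [freeVars]
  | equal t₁ t₂ => simpa [SubformulasAtMost] using h
  | rel R ts => simpa [SubformulasAtMost] using h
  | imp φ ψ =>
    simp only [SubformulasAtMost] at h
    exact h.1
  | all φ =>
    simp only [SubformulasAtMost] at h
    exact h.1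

theorem Sum.elim_snoc_map_castSucc {β X : Type*} {n : ℕ} (v : β → X) (x : Fin n → X) (a : X)
    (z : β ⊕ Fin n) : Sum.elim v (Fin.snoc x a : Fin (n + 1) → X) (Sum.map id Fin.castSucc z) =
      Sum.elim v x z := by
  rcases z with z | z <;> simp

theorem exists_var_eq {β : Type*} (t : (extLang L m).Term β) :
    ∃ b, t = FirstOrder.Language.Term.var b := by
  cases t with
  | var b => exact ⟨b, rfl⟩
  | func f _ => exact Empty.elim f

namespace BackForth

variable {S₁ : Stage M₁ m} {S₂ : Stage M₂ m} {R : SupportedRel M₁ M₂}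
  (B : BackForth L Y₁ Y₂ H S₁ S₂ R) (W : IsKWitness L k Y₁ Y₂ H)

include B W

/-- Only the free variables of the current subformula need to be linked by `g`. This is why a bound
on the free variables of each subformula suffices, however deeply quantifiers are nested. -/
theorem realize_iff (hk : 0 < k) {β : Type*} {n : ℕ} (φ : (extLang L m).BoundedFormula β n)
    (hφ : SubformulasAtMost k φ) {g : M₁ ≃. M₂} (hg : g ∈ H) (v₁ : β → S₁.univ)
    (v₂ : β → S₂.univ) (x₁ : Fin n → S₁.univ) (x₂ : Fin n → S₂.univ)
    (hl : ∀ z ∈ freeVars φ, Linked R g (Sum.elim v₁ x₁ z : S₁.univ) (Sum.elim v₂ x₂ z : S₂.univ)) :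
    @FirstOrder.Language.BoundedFormula.Realize _ _ (S₁.str L) _ _ φ v₁ x₁ ↔
      @FirstOrder.Language.BoundedFormula.Realize _ _ (S₂.str L) _ _ φ v₂ x₂ := by
  let := S₁.str L
  let := S₂.str L
  induction φ generalizing g with
  | falsum => exact Iff.rfl
  | equal t₁ t₂ =>
    obtain ⟨b₁, rfl⟩ := exists_var_eq t₁
    obtain ⟨b₂, rfl⟩ := exists_var_eq t₂
    have := B.eq g hg (hl b₁ (by simp [freeVars, termVars])) (hl b₂ (by simp [freeVars, termVars]))
    rw [← Subtype.ext_iff, ← Subtype.ext_iff] at this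
    exact this
  | rel r ts =>
    choose b hb using fun i => exists_var_eq (ts i)
    obtain rfl : ts = fun i => FirstOrder.Language.Term.var (b i) := funext hb
    exact B.holds g hg r _ _ fun i => hl (b i) (by
      simp only [freeVars, termVars, Set.mem_iUnion, Set.mem_singleton_iff]
      exact ⟨i, rfl⟩)
  | imp φ ψ ihφ ihψ =>
    simp only [SubformulasAtMost] at hφ
    have h₁ := ihφ hφ.2.1 hg x₁ x₂ fun z hz => hl z (by simp [freeVars, hz])
    have h₂ := ihψ hφ.2.2 hg x₁ x₂ fun z hz => hl z (by simp [freeVars, hz])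
    exact imp_congr h₁ h₂
  | @all n φ ih =>
    simp only [SubformulasAtMost] at hφ
    -- If the quantified variable really occurs, the quantified formula has one free variable fewer
    -- than its body, hence at most `k - 1`, and a pebble is available.
    by_cases hlast : (Sum.inr (Fin.last n) : β ⊕ Fin (n + 1)) ∈ freeVars φ
    · have hfin' : (freeVars (.all φ)).Finite := by
        refine Set.finite_of_encard_le_coe hφ.1
      have hcard : hfin'.toFinset.card + 1 ≤ k := by
        have hinj : Function.Injective (Sum.map id Fin.castSucc : β ⊕ Fin n → β ⊕ Fin (n + 1)) :=
          Function.Injective.sumMap Function.injective_id (Fin.castSucc_injective n)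
        have hsub : insert (Sum.inr (Fin.last n))
            (Sum.map id Fin.castSucc '' (freeVars (.all φ))) ⊆ freeVars φ := by
          rw [Set.insert_subset_iff]
          refine ⟨hlast, ?_⟩
          rintro _ ⟨z, hz, rfl⟩
          exact hz
        have := (Set.encard_le_encard hsub).trans (encard_freeVars_le hφ.2)
        rw [Set.encard_insert_of_notMem, hinj.encard_image, hfin'.encard_eq_coe_toFinset_card]
          at this
        · exact_mod_cast this
        · rintro ⟨z | z, -, hz⟩
          · simp at hz
          · simp only [Sum.map_inr, Sum.inr.injEq] at hz
            exact (Fin.castSucc_lt_last z).ne hz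
      refine B.forall_iff W hk hcard hg (p := fun z => (Sum.elim v₁ x₁ z : S₁.univ))
        (q := fun z => (Sum.elim v₂ x₂ z : S₂.univ))
        (fun z hz => hl z (hfin'.mem_toFinset.1 hz)) fun g' hg' hl' x y hxy => ?_
      refine ih hφ.2 hg' _ _ ?_
      have key : ∀ z : β ⊕ Fin n, Sum.map id Fin.castSucc z ∈ freeVars φ →
          Linked R g' (Sum.elim v₁ (Fin.snoc x₁ x : Fin (n + 1) → S₁.univ)
            (Sum.map id Fin.castSucc z) : S₁.univ)
            (Sum.elim v₂ (Fin.snoc x₂ y : Fin (n + 1) → S₂.univ)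
            (Sum.map id Fin.castSucc z) : S₂.univ) := by
        intro z hz
        rw [Sum.elim_snoc_map_castSucc, Sum.elim_snoc_map_castSucc]
        exact hl' z (hfin'.mem_toFinset.2 hz)
      rintro (z | z) hz
      · exact key (Sum.inl z) hz
      · induction z using Fin.lastCases with
        | last => simpa using hxy
        | cast z => exact key (Sum.inr z) hz
    -- For a vacuous quantifier all `k` pebbles may be in use, so `g` cannot be extended. It need
    -- not be: the new object is irrelevant to the body, which is compared along the old `g`, while
    -- the game only shows that each side has an object to instantiate.
    · refine B.forall_iff W hk (S := (∅ : Finset Empty)) hk hg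
        (p := Empty.elim) (q := Empty.elim) (by simp) fun g' hg' hl' x y hxy => ?_
      refine ih hφ.2 hg _ _ ?_
      have key : ∀ z : β ⊕ Fin n, Sum.map id Fin.castSucc z ∈ freeVars φ →
          Linked R g (Sum.elim v₁ (Fin.snoc x₁ x : Fin (n + 1) → S₁.univ)
            (Sum.map id Fin.castSucc z) : S₁.univ)
            (Sum.elim v₂ (Fin.snoc x₂ y : Fin (n + 1) → S₂.univ)
            (Sum.map id Fin.castSucc z) : S₂.univ) := by
        intro z hz
        rw [Sum.elim_snoc_map_castSucc, Sum.elim_snoc_map_castSucc]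
        exact hl z hz
      rintro (z | z) hz
      · exact key (Sum.inl z) hz
      · induction z using Fin.lastCases with
        | last => exact (hlast hz).elim
        | cast z => exact key (Sum.inr z) hz

theorem sat_iff (hk : 0 < k) {β : Type*} (φ : (extLang L m).Formula β)
    (hφ : SubformulasAtMost k φ) {g : M₁ ≃. M₂} (hg : g ∈ H) (v₁ : β → S₁.univ)
    (v₂ : β → S₂.univ) (hl : ∀ z, Linked R g (v₁ z) (v₂ z)) :
    S₁.Sat L φ v₁ ↔ S₂.Sat L φ v₂ := by
  refine B.realize_iff W hk φ hφ hg v₁ v₂ _ _ ?_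
  rintro (z | z) -
  · exact hl z
  · exact z.elim0

end BackForth

end BackAndForth

/-! ### Correspondence of objects through supports, stage by stage. -/

section Matching

variable {L : FirstOrder.Language.{u, v}} {M₁ : Type w} {M₂ : Type w'} [L.Structure M₁]
  [L.Structure M₂] {k : ℕ}

namespace InductiveScheme

/-- The object `x` of `N_t[M₁]` with support `h` corresponds to the object `y` of `N_t[M₂]` with
support `h'`: either both are corresponding urelements, or all maps in `H` that carry `h` to `h'`
respect membership in `x` and `y` for corresponding objects of the preceding stage. -/
def Matched (U : InductiveScheme L) (Y₁ : SupportData M₁) (Y₂ : SupportData M₂)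
    (H : Set (M₁ ≃. M₂)) : ℕ → SupportedRel M₁ M₂
  | 0 => fun n h h' x y => Set.range h ∈ Y₁.I ∧ Set.range h' ∈ Y₂.I ∧
      ∃ i : Fin n, x = HF.atom (h i) ∧ y = HF.atom (h' i)
  | t + 1 => fun n h h' x y => Set.range h ∈ Y₁.I ∧ Set.range h' ∈ Y₂.I ∧
      ((∃ i : Fin n, x = HF.atom (h i) ∧ y = HF.atom (h' i)) ∨
        (x ∈ (U.stage M₁ (t + 1)).univ ∧ y ∈ (U.stage M₂ (t + 1)).univ ∧ x.IsSet ∧ y.IsSet ∧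
          ∀ g ∈ H, g.Carries h h' → ∀ z w, Linked (Matched U Y₁ Y₂ H t) g z w →
            (HF.Elem z x ↔ HF.Elem w y)))

variable (U : InductiveScheme L) {Y₁ : SupportData M₁} {Y₂ : SupportData M₂}
  {H : Set (M₁ ≃. M₂)}

theorem Matched.range₁ {t n : ℕ} {h : Fin n → M₁} {h' : Fin n → M₂} {x y}
    (hm : U.Matched Y₁ Y₂ H t n h h' x y) : Set.range h ∈ Y₁.I := by
  cases t <;> exact hm.1

theorem Matched.range₂ {t n : ℕ} {h : Fin n → M₁} {h' : Fin n → M₂} {x y}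
    (hm : U.Matched Y₁ Y₂ H t n h h' x y) : Set.range h' ∈ Y₂.I := by
  cases t <;> exact hm.2.1

theorem Matched.atom (t : ℕ) {n : ℕ} {h : Fin n → M₁} {h' : Fin n → M₂} (hh : Set.range h ∈ Y₁.I)
    (hh' : Set.range h' ∈ Y₂.I) (i : Fin n) :
    U.Matched Y₁ Y₂ H t n h h' (HF.atom (h i)) (HF.atom (h' i)) := by
  cases t
  · exact ⟨hh, hh', i, rfl, rfl⟩
  · exact ⟨hh, hh', Or.inl ⟨i, rfl, rfl⟩⟩

theorem Matched.mem₁ {t n : ℕ} {h : Fin n → M₁} {h' : Fin n → M₂} {x y}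
    (hm : U.Matched Y₁ Y₂ H t n h h' x y) : x ∈ (U.stage M₁ t).univ := by
  cases t with
  | zero => obtain ⟨-, -, i, rfl, -⟩ := hm; exact U.atom_mem_stage M₁ _ _
  | succ t =>
    obtain ⟨-, -, ⟨i, rfl, -⟩ | hm⟩ := hm
    · exact U.atom_mem_stage M₁ _ _
    · exact hm.1

theorem Matched.mem₂ {t n : ℕ} {h : Fin n → M₁} {h' : Fin n → M₂} {x y}
    (hm : U.Matched Y₁ Y₂ H t n h h' x y) : y ∈ (U.stage M₂ t).univ := by
  cases t with
  | zero => obtain ⟨-, -, i, -, rfl⟩ := hm; exact U.atom_mem_stage M₂ _ _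
  | succ t =>
    obtain ⟨-, -, ⟨i, -, rfl⟩ | hm⟩ := hm
    · exact U.atom_mem_stage M₂ _ _
    · exact hm.2.1

theorem Matched.atom_or_isSet {t n : ℕ} {h : Fin n → M₁} {h' : Fin n → M₂} {x y}
    (hm : U.Matched Y₁ Y₂ H t n h h' x y) :
    (∃ i, x = HF.atom (h i) ∧ y = HF.atom (h' i)) ∨ (x.IsSet ∧ y.IsSet) := by
  cases t with
  | zero => exact Or.inl hm.2.2
  | succ t => exact hm.2.2.imp id fun hm => ⟨hm.2.2.1, hm.2.2.2.1⟩

theorem linked_symm {R : SupportedRel M₁ M₂} {R' : SupportedRel M₂ M₁}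
    (hR : ∀ n h h' x y, R' n h' h y x ↔ R n h h' x y) {g : M₁ ≃. M₂} {x : HF M₁} {y : HF M₂} :
    Linked R' g.symm y x ↔ Linked R g x y := by
  constructor
  · rintro ⟨n, h', h, hc, hr⟩
    exact ⟨n, h, h', PEquiv.carries_symm.1 hc, (hR _ _ _ _ _).1 hr⟩
  · rintro ⟨n, h, h', hc, hr⟩
    exact ⟨n, h', h, PEquiv.carries_symm.2 hc, (hR _ _ _ _ _).2 hr⟩

/-- The definition treats both sides alike. All later arguments are therefore given in one direction
and applied to the inverse witness for the other. -/
theorem matched_symm (t : ℕ) : ∀ (n : ℕ) (h : Fin n → M₁) (h' : Fin n → M₂) (x : HF M₁)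
    (y : HF M₂), U.Matched Y₂ Y₁ (PEquiv.symm '' H) t n h' h y x ↔
      U.Matched Y₁ Y₂ H t n h h' x y := by
  induction t with
  | zero =>
    intro n h h' x y
    simp only [Matched]
    constructor <;> rintro ⟨h₁, h₂, i, h₃, h₄⟩ <;> exact ⟨h₂, h₁, i, h₄, h₃⟩
  | succ t ih =>
    intro n h h' x y
    simp only [Matched]
    constructor
    · rintro ⟨h₁, h₂, ⟨i, h₃, h₄⟩ | ⟨hy, hx, sy, sx, hm⟩⟩
      · exact ⟨h₂, h₁, Or.inl ⟨i, h₄, h₃⟩⟩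
      · exact ⟨h₂, h₁, Or.inr ⟨hx, hy, sx, sy, fun g hg hc z w hl =>
          (hm g.symm ⟨g, hg, rfl⟩ (PEquiv.carries_symm.2 hc) w z ((linked_symm ih).2 hl)).symm⟩⟩
    · rintro ⟨h₁, h₂, ⟨i, h₃, h₄⟩ | ⟨hx, hy, sx, sy, hm⟩⟩
      · exact ⟨h₂, h₁, Or.inl ⟨i, h₄, h₃⟩⟩
      · refine ⟨h₂, h₁, Or.inr ⟨hy, hx, sy, sx, ?_⟩⟩
        rintro _ ⟨g, hg, rfl⟩ hc w z hl
        exact (hm g hg (PEquiv.carries_symm.1 hc) z w ((linked_symm ih).1 hl)).symm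

theorem linked_matched_symm {t : ℕ} {g : M₁ ≃. M₂} {x : HF M₁} {y : HF M₂} :
    Linked (U.Matched Y₂ Y₁ (PEquiv.symm '' H) t) g.symm y x ↔
      Linked (U.Matched Y₁ Y₂ H t) g x y :=
  linked_symm (U.matched_symm t)

/-- Every object of `N_t[M₁]` has a support `h` such that every map in `H` defined on `h` takes it
to some object of `N_t[M₂]`. -/
def Total (Y₁ : SupportData M₁) (Y₂ : SupportData M₂) (H : Set (M₁ ≃. M₂)) (t : ℕ) : Prop :=
  ∀ x ∈ (U.stage M₁ t).univ, ∃ (n : ℕ) (h : Fin n → M₁), Set.range h ∈ Y₁.I ∧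
    ∀ g ∈ H, ∀ h', g.Carries h h' → ∃ y, U.Matched Y₁ Y₂ H t n h h' x y

/-- Totality in both directions. -/
def BiTotal (Y₁ : SupportData M₁) (Y₂ : SupportData M₂) (H : Set (M₁ ≃. M₂)) (t : ℕ) : Prop :=
  U.Total Y₁ Y₂ H t ∧ U.Total Y₂ Y₁ (PEquiv.symm '' H) t

theorem symm_symm_image : PEquiv.symm '' (PEquiv.symm '' H) = H := by
  rw [Set.image_image]
  simp only [PEquiv.symm_symm, Set.image_id']

variable {U}

theorem BiTotal.symm {t : ℕ} (hT : U.BiTotal Y₁ Y₂ H t) :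
    U.BiTotal Y₂ Y₁ (PEquiv.symm '' H) t :=
  ⟨hT.2, by rw [symm_symm_image]; exact hT.1⟩

section

variable (W : IsKWitness L k Y₁ Y₂ H) (hk : 3 ≤ k)

include W hk

/-- Two supports are kept while a third is added; this is the use of `3 ≤ k`. -/
theorem Total.exists_linked {t : ℕ} (hT : U.Total Y₁ Y₂ H t) {g : M₁ ≃. M₂} (hg : g ∈ H)
    {n n' : ℕ} {h : Fin n → M₁} {h' : Fin n → M₂} {c : Fin n' → M₁} {c' : Fin n' → M₂}
    (hh : Set.range h ∈ Y₁.I) (hc : Set.range c ∈ Y₁.I) (hgh : g.Carries h h')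
    (hgc : g.Carries c c') {x : HF M₁} (hx : x ∈ (U.stage M₁ t).univ) :
    ∃ g' ∈ H, ∃ y, g'.Carries h h' ∧ g'.Carries c c' ∧ Linked (U.Matched Y₁ Y₂ H t) g' x y := by
  obtain ⟨n, d, hd, hm⟩ := hT x hx
  obtain ⟨g', hg', d', hd', hkeep⟩ := W.exists_carries (by omega) (by omega : 1 + (1 + 1) ≤ k) hg
    (union_mem_unionsOf (mem_unionsOf_one hh) (mem_unionsOf_one hc)) (mem_unionsOf_one hd)
  obtain ⟨y, hy⟩ := hm g' hg' d' hd'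
  exact ⟨g', hg', y, hkeep _ _ Set.subset_union_left hgh, hkeep _ _ Set.subset_union_right hgc,
    n, d, d', hd', hy⟩

theorem BiTotal.exists_linked_back {t : ℕ} (hT : U.BiTotal Y₁ Y₂ H t) {g : M₁ ≃. M₂} (hg : g ∈ H)
    {n n' : ℕ} {h : Fin n → M₁} {h' : Fin n → M₂} {c : Fin n' → M₁} {c' : Fin n' → M₂}
    (hh : Set.range h' ∈ Y₂.I) (hc : Set.range c' ∈ Y₂.I) (hgh : g.Carries h h')
    (hgc : g.Carries c c') {y : HF M₂} (hy : y ∈ (U.stage M₂ t).univ) :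
    ∃ g' ∈ H, ∃ x, g'.Carries h h' ∧ g'.Carries c c' ∧ Linked (U.Matched Y₁ Y₂ H t) g' x y := by
  obtain ⟨_, ⟨g', hg', rfl⟩, x, h₁, h₂, hl⟩ := hT.2.exists_linked W.symm hk ⟨g, hg, rfl⟩ hh hc
    (PEquiv.carries_symm.2 hgh) (PEquiv.carries_symm.2 hgc) hy
  exact ⟨g', hg', x, PEquiv.carries_symm.1 h₁, PEquiv.carries_symm.1 h₂,
    U.linked_matched_symm.1 hl⟩

theorem BiTotal.forall_iff {t : ℕ} (hT : U.BiTotal Y₁ Y₂ H t) {g : M₁ ≃. M₂} (hg : g ∈ H)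
    {n : ℕ} {h : Fin n → M₁} {h' : Fin n → M₂} (hh : Set.range h ∈ Y₁.I)
    (hh' : Set.range h' ∈ Y₂.I) (hgh : g.Carries h h') {P : HF M₁ → Prop} {Q : HF M₂ → Prop}
    (hPQ : ∀ g' ∈ H, g'.Carries h h' → ∀ x y, Linked (U.Matched Y₁ Y₂ H t) g' x y →
      (P x ↔ Q y)) :
    (∀ x ∈ (U.stage M₁ t).univ, P x) ↔ ∀ y ∈ (U.stage M₂ t).univ, Q y := by
  constructor
  · intro hP y hy
    obtain ⟨g', hg', x, h₁, -, hl⟩ := hT.exists_linked_back W hk hg hh' hh' hgh hgh hy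
    have hl' := hl
    obtain ⟨_, _, _, -, hm⟩ := hl'
    exact (hPQ g' hg' h₁ x y hl).1 (hP x hm.mem₁)
  · intro hQ x hx
    obtain ⟨g', hg', y, h₁, -, hl⟩ := hT.1.exists_linked W hk hg hh hh hgh hgh hx
    have hl' := hl
    obtain ⟨_, _, _, -, hm⟩ := hl'
    exact (hPQ g' hg' h₁ x y hl).2 (hQ y hm.mem₂)

end

theorem matched_atom_right_eq {t n n' : ℕ} {g : M₁ ≃. M₂} {h : Fin n → M₁} {h' : Fin n → M₂}
    {c : Fin n' → M₁} {c' : Fin n' → M₂} (hgh : g.Carries h h') (hgc : g.Carries c c')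
    {y : HF M₂} (i : Fin n) (hm : U.Matched Y₁ Y₂ H t n' c c' (HF.atom (h i)) y) :
    y = HF.atom (h' i) := by
  obtain ⟨j, hj, rfl⟩ | ⟨hs, -⟩ := hm.atom_or_isSet
  · have := hgc j
    rw [← HF.atom_injective hj] at this
    rw [Option.mem_unique (hgh i) this]
  · exact (HF.not_isSet_atom _ hs).elim

section

variable (W : IsKWitness L k Y₁ Y₂ H) (hk : 3 ≤ k)

include W hk

/-- Extensionality: an element `z` of the preceding stage is pulled back to some `v` by a map that
keeps both supports of `x`. Then `z` lies in `y`, and likewise in `w`, exactly if `v` lies in `x`.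
-/
theorem BiTotal.right_unique {t : ℕ} (hT : ∀ s < t, U.BiTotal Y₁ Y₂ H s) {g : M₁ ≃. M₂}
    (hg : g ∈ H) {x : HF M₁} {y w : HF M₂} (hy : Linked (U.Matched Y₁ Y₂ H t) g x y)
    (hw : Linked (U.Matched Y₁ Y₂ H t) g x w) : y = w := by
  obtain ⟨n, h, h', hgh, hm⟩ := hy
  obtain ⟨n', c, c', hgc, hm'⟩ := hw
  obtain ⟨i, rfl, rfl⟩ | ⟨hsx, hsy⟩ := hm.atom_or_isSet
  · exact (matched_atom_right_eq hgh hgc i hm').symm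
  · obtain ⟨j, rfl, -⟩ | ⟨-, hsw⟩ := hm'.atom_or_isSet
    · exact (HF.not_isSet_atom _ hsx).elim
    cases t with
    | zero =>
      obtain ⟨-, -, i, rfl, -⟩ := hm
      exact (HF.not_isSet_atom _ hsx).elim
    | succ t =>
      obtain ⟨-, hr, ⟨i, rfl, -⟩ | ⟨-, hy, -, -, hm⟩⟩ := hm
      · exact (HF.not_isSet_atom _ hsx).elim
      obtain ⟨-, hr', ⟨i, rfl, -⟩ | ⟨-, hw, -, -, hm'⟩⟩ := hm'
      · exact (HF.not_isSet_atom _ hsx).elim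
      refine HF.ext_of_elem hsy hsw fun z => ?_
      by_cases hz : z ∈ (U.stage M₂ t).univ
      · obtain ⟨g', hg', v, h₁, h₂, hl⟩ :=
          (hT t t.lt_succ_self).exists_linked_back W hk hg hr hr' hgh hgc hz
        rw [← hm g' hg' h₁ v z hl, ← hm' g' hg' h₂ v z hl]
      · exact iff_of_false (fun h => hz (U.elem_mem_stage_of_succ M₂ t hy h))
          (fun h => hz (U.elem_mem_stage_of_succ M₂ t hw h))

theorem BiTotal.eq_iff {t : ℕ} (hT : ∀ s < t, U.BiTotal Y₁ Y₂ H s) {g : M₁ ≃. M₂}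
    (hg : g ∈ H) {x z : HF M₁} {y w : HF M₂} (hy : Linked (U.Matched Y₁ Y₂ H t) g x y)
    (hw : Linked (U.Matched Y₁ Y₂ H t) g z w) : x = z ↔ y = w := by
  constructor
  · rintro rfl
    exact right_unique W hk hT hg hy hw
  · rintro rfl
    exact right_unique W.symm hk (fun s hs => (hT s hs).symm) ⟨g, hg, rfl⟩
      (U.linked_matched_symm.2 hy) (U.linked_matched_symm.2 hw)

/-- The clause defining `Matched` at `t + 1` concerns elements linked at `t`, whereas here `x` is
linked only at `t + 1`. Being an element of `z`, it belongs to `N_t` and so has a partner at level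
`t`, which by uniqueness is `y`. -/
theorem BiTotal.elem_of_elem {t : ℕ} (hT : ∀ s < t + 1, U.BiTotal Y₁ Y₂ H s)
    (hmono : ∀ (n : ℕ) (h : Fin n → M₁) (h' : Fin n → M₂) x y, U.Matched Y₁ Y₂ H t n h h' x y →
      U.Matched Y₁ Y₂ H (t + 1) n h h' x y) {g : M₁ ≃. M₂}
    (hg : g ∈ H) {x z : HF M₁} {y w : HF M₂} (hx : Linked (U.Matched Y₁ Y₂ H (t + 1)) g x y)
    (hz : Linked (U.Matched Y₁ Y₂ H (t + 1)) g z w) (he : HF.Elem x z) : HF.Elem y w := by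
  obtain ⟨n, h, h', hgh, hm⟩ := hx
  obtain ⟨n', c, c', hgc, hm'⟩ := hz
  have hxt : x ∈ (U.stage M₁ t).univ := U.elem_mem_stage_of_succ M₁ t hm'.mem₁ he
  obtain ⟨g', hg', y', h₁, h₂, hl⟩ := (hT t t.lt_succ_self).1.exists_linked W hk hg hm.range₁
    hm'.range₁ hgh hgc hxt
  obtain ⟨-, -, ⟨i, rfl, -⟩ | ⟨-, -, -, -, hm'⟩⟩ := hm'
  · exact (HF.not_elem_atom _ _ _ he).elim
  have : y' = y := by
    obtain ⟨l, d, d', hd, hmd⟩ := hl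
    exact right_unique W hk hT hg' ⟨l, d, d', hd, hmono _ _ _ _ _ hmd⟩ ⟨n, h, h', h₁, hm⟩
  rw [← this]
  exact (hm' g' hg' h₂ x y' hl).1 he

/-- Raising the level enlarges the class of linked pairs against which membership is tested;
`elem_of_elem`, used in both directions, shows that the additional tests succeed. -/
theorem BiTotal.matched_succ {t : ℕ} (hT : ∀ s < t, U.BiTotal Y₁ Y₂ H s) :
    ∀ (n : ℕ) (h : Fin n → M₁) (h' : Fin n → M₂) x y, U.Matched Y₁ Y₂ H t n h h' x y →
      U.Matched Y₁ Y₂ H (t + 1) n h h' x y := by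
  induction t with
  | zero =>
    rintro n h h' _ _ ⟨h₁, h₂, i, rfl, rfl⟩
    exact Matched.atom U _ h₁ h₂ i
  | succ t ih =>
    intro n h h' x y hm
    obtain ⟨i, rfl, rfl⟩ | ⟨hsx, hsy⟩ := hm.atom_or_isSet
    · exact Matched.atom U _ hm.range₁ hm.range₂ i
    have hmono := ih fun s hs => hT s (by omega)
    have hmono' : ∀ (n : ℕ) (h : Fin n → M₂) (h' : Fin n → M₁) x y,
        U.Matched Y₂ Y₁ (PEquiv.symm '' H) t n h h' x y →
        U.Matched Y₂ Y₁ (PEquiv.symm '' H) (t + 1) n h h' x y := fun n h h' x y hm =>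
      (U.matched_symm _ _ _ _ _ _).2 (hmono _ _ _ _ _ ((U.matched_symm _ _ _ _ _ _).1 hm))
    refine ⟨hm.range₁, hm.range₂, Or.inr ⟨U.stage_subset_succ M₁ _ hm.mem₁,
      U.stage_subset_succ M₂ _ hm.mem₂, hsx, hsy, fun g hg hgh z w hl => ⟨fun he => ?_,
        fun he => ?_⟩⟩⟩
    · exact elem_of_elem W hk hT hmono hg hl ⟨n, h, h', hgh, hm⟩ he
    · exact elem_of_elem W.symm hk (fun s hs => (hT s hs).symm) hmono' ⟨g, hg, rfl⟩
        (U.linked_matched_symm.2 hl) (U.linked_matched_symm.2 ⟨n, h, h', hgh, hm⟩) he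

theorem BiTotal.matched_mono {t s : ℕ} (hst : s ≤ t) (hT : ∀ s < t, U.BiTotal Y₁ Y₂ H s)
    {n : ℕ} {h : Fin n → M₁} {h' : Fin n → M₂} {x y} (hm : U.Matched Y₁ Y₂ H s n h h' x y) :
    U.Matched Y₁ Y₂ H t n h h' x y := by
  induction t, hst using Nat.le_induction with
  | base => exact hm
  | succ t hst ih =>
    exact matched_succ W hk (fun s hs => hT s (by omega)) _ _ _ _ _
      (ih fun s hs => hT s (by omega))

theorem BiTotal.elem_iff {t : ℕ} (hT : ∀ s < t, U.BiTotal Y₁ Y₂ H s) {g : M₁ ≃. M₂}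
    (hg : g ∈ H) {x z : HF M₁} {y w : HF M₂} (hx : Linked (U.Matched Y₁ Y₂ H t) g x y)
    (hz : Linked (U.Matched Y₁ Y₂ H t) g z w) : HF.Elem x z ↔ HF.Elem y w := by
  obtain ⟨n, c, c', hgc, hm⟩ := hz
  cases t with
  | zero =>
    obtain ⟨-, -, i, rfl, rfl⟩ := hm
    exact iff_of_false (HF.not_elem_atom _ _ _) (HF.not_elem_atom _ _ _)
  | succ t =>
    -- Raised by one level, the correspondence of `z` and `w` tests membership on pairs linked at
    -- the level of `x` and `y`.
    have hm' := matched_succ W hk hT _ _ _ _ _ hm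
    obtain ⟨-, -, ⟨i, rfl, rfl⟩ | ⟨-, -, -, -, hm'⟩⟩ := hm'
    · exact iff_of_false (HF.not_elem_atom _ _ _) (HF.not_elem_atom _ _ _)
    · exact hm' g hg hgc x y hx

end

theorem exists_atoms_of_linked {R : SupportedRel M₁ M₂} {g : M₁ ≃. M₂}
    (hR : ∀ n h h' x y, R n h h' x y →
      (∃ i : Fin n, x = HF.atom (h i) ∧ y = HF.atom (h' i)) ∨ (x.IsSet ∧ y.IsSet))
    {x : HF M₁} {y : HF M₂} (hl : Linked R g x y) {a : M₁} (ha : x = HF.atom a) :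
    ∃ b ∈ g a, y = HF.atom b := by
  obtain ⟨n, h, h', hgh, hm⟩ := hl
  obtain ⟨i, hi, rfl⟩ | ⟨hs, -⟩ := hR _ _ _ _ _ hm
  · rw [ha] at hi
    rw [HF.atom_injective hi]
    exact ⟨_, hgh i, rfl⟩
  · rw [ha] at hs
    exact (HF.not_isSet_atom _ hs).elim

/-- Relations that hold of urelements only transfer along partial isomorphisms. -/
theorem exists_atoms_iff {R : SupportedRel M₁ M₂} {g : M₁ ≃. M₂}
    (hR : ∀ n h h' x y, R n h h' x y →
      (∃ i : Fin n, x = HF.atom (h i) ∧ y = HF.atom (h' i)) ∨ (x.IsSet ∧ y.IsSet))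
    {n : ℕ} {x : Fin n → HF M₁} {y : Fin n → HF M₂} (hl : ∀ i, Linked R g (x i) (y i))
    {P : (Fin n → M₁) → Prop} {Q : (Fin n → M₂) → Prop}
    (hPQ : ∀ a b, g.Carries a b → (P a ↔ Q b)) :
    (∃ a, (∀ i, x i = HF.atom (a i)) ∧ P a) ↔ ∃ b, (∀ i, y i = HF.atom (b i)) ∧ Q b := by
  constructor
  · rintro ⟨a, ha, hP⟩
    choose b hb hyb using fun i => exists_atoms_of_linked hR (hl i) (ha i)
    exact ⟨b, hyb, (hPQ a b hb).1 hP⟩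
  · rintro ⟨b, hb, hQ⟩
    have hR' : ∀ n (h : Fin n → M₂) (h' : Fin n → M₁) x y, R n h' h y x →
      (∃ i : Fin n, x = HF.atom (h i) ∧ y = HF.atom (h' i)) ∨ (x.IsSet ∧ y.IsSet) :=
      fun n h h' x y hr => (hR _ _ _ _ _ hr).imp (fun ⟨i, h₁, h₂⟩ => ⟨i, h₂, h₁⟩) And.symm
    choose a ha hxa using fun i => exists_atoms_of_linked (R := fun n h h' x y => R n h' h y x)
      (g := g.symm) hR' ((linked_symm fun _ _ _ _ _ => Iff.rfl).2 (hl i)) (hb i)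
    exact ⟨a, hxa, (hPQ a b fun i => (PEquiv.mem_iff_mem g).1 (ha i)).2 hQ⟩

/-- Makes "being the set `C`" a statement quantified over the preceding stage, to which the
back-and-forth argument applies. -/
theorem isSetOf_iff {t : ℕ} {M : Type*} [L.Structure M] {x : HF M} {C : Set (HF M)}
    (hx : x ∈ (U.stage M (t + 1)).univ) (hC : C ⊆ (U.stage M t).univ) :
    HF.IsSetOf C x ↔ x.IsSet ∧ ∀ z ∈ (U.stage M t).univ, (HF.Elem z x ↔ z ∈ C) := by
  refine and_congr_right fun _ => ⟨fun h z _ => h z, fun h z => ?_⟩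
  by_cases hz : z ∈ (U.stage M t).univ
  · exact h z hz
  · exact iff_of_false (fun h => hz (U.elem_mem_stage_of_succ M t hx h)) fun h => hz (hC h)

/-- Any correspondence between stages that is compatible with equality, membership and the new
predicates is compatible with all atomic formulas. -/
theorem BackForth.mk_of_matched (W : IsKWitness L k Y₁ Y₂ H) {m : ℕ} {S₁ : Stage M₁ m} {S₂ : Stage M₂ m}
    {R : SupportedRel M₁ M₂}
    (hR : ∀ n h h' x y, R n h h' x y → ∃ t, U.Matched Y₁ Y₂ H t n h h' x y)
    (mem : ∀ n h h' x y, R n h h' x y → x ∈ S₁.univ ∧ y ∈ S₂.univ)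
    (forth : ∀ x ∈ S₁.univ, ∃ (n : ℕ) (h : Fin n → M₁), Set.range h ∈ Y₁.I ∧
      ∀ g ∈ H, ∀ h', g.Carries h h' → ∃ y, R n h h' x y)
    (back : ∀ y ∈ S₂.univ, ∃ (n : ℕ) (h' : Fin n → M₂), Set.range h' ∈ Y₂.I ∧
      ∀ g ∈ H, ∀ h, g.Carries h h' → ∃ x, R n h h' x y)
    (coh : ∀ g ∈ H, ∀ {x y z w}, Linked R g x y → Linked R g z w →
      (x = z ↔ y = w) ∧ (HF.Elem x z ↔ HF.Elem y w))
    (pred : ∀ g ∈ H, ∀ {x y}, Linked R g x y → ∀ i, (x ∈ S₁.pred i ↔ y ∈ S₂.pred i)) :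
    BackForth L Y₁ Y₂ H S₁ S₂ R where
  range₁ hr := (hR _ _ _ _ _ hr).choose_spec.range₁
  range₂ hr := (hR _ _ _ _ _ hr).choose_spec.range₂
  mem₁ hr := (mem _ _ _ _ _ hr).1
  mem₂ hr := (mem _ _ _ _ _ hr).2
  forth := forth
  back := back
  eq g hg _ _ _ _ h₁ h₂ := (coh g hg h₁ h₂).1
  holds g hg n r x y hl := by
    have hR' : ∀ n h h' x y, R n h h' x y →
        (∃ i : Fin n, x = HF.atom (h i) ∧ y = HF.atom (h' i)) ∨ (x.IsSet ∧ y.IsSet) :=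
      fun n h h' x y hr => (hR _ _ _ _ _ hr).choose_spec.atom_or_isSet
    cases r with
    | rel r => exact exists_atoms_iff hR' hl ((W.partialIso g hg).rel r)
    | graph F =>
      exact exists_atoms_iff hR' hl fun a b hab =>
        (W.partialIso g hg).func F _ _ _ _ (fun i => hab i.castSucc) (hab (Fin.last _))
    | mem => exact (coh g hg (hl 0) (hl 1)).2
    | pred i => exact pred g hg (hl 0) i

section

variable (W : IsKWitness L k Y₁ Y₂ H) (hk : 3 ≤ k)

include W hk

theorem BackForth.update_iff {t : ℕ} {R : SupportedRel M₁ M₂}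
    (B : BackForth L Y₁ Y₂ H (U.stage M₁ t) (U.stage M₂ t) R)
    (hφ : ∀ ℓ, SubformulasAtMost k (U.phi ℓ)) {g : M₁ ≃. M₂} (hg : g ∈ H) {x : HF M₁}
    {y : HF M₂} (hl : Linked R g x y) (ℓ : Fin U.m₁) :
    x ∈ U.update M₁ (U.stage M₁ t) ℓ ↔ y ∈ U.update M₂ (U.stage M₂ t) ℓ := by
  have hl' := hl
  obtain ⟨_, _, _, -, hm⟩ := hl'
  have := B.sat_iff W (by omega) (U.phi ℓ) (hφ ℓ) hg (fun _ => ⟨x, B.mem₁ hm⟩)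
    (fun _ => ⟨y, B.mem₂ hm⟩) fun _ => hl
  exact ⟨fun ⟨_, h⟩ => ⟨B.mem₂ hm, this.1 h⟩, fun ⟨_, h⟩ => ⟨B.mem₁ hm, this.2 h⟩⟩

theorem BiTotal.backForth_of_pred {t : ℕ} (hT : ∀ s ≤ t, U.BiTotal Y₁ Y₂ H s)
    (pred : ∀ g ∈ H, ∀ {x y}, Linked (U.Matched Y₁ Y₂ H t) g x y →
      ∀ i, (x ∈ (U.stage M₁ t).pred i ↔ y ∈ (U.stage M₂ t).pred i)) :
    BackForth L Y₁ Y₂ H (U.stage M₁ t) (U.stage M₂ t) (U.Matched Y₁ Y₂ H t) := by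
  have hT' : ∀ s < t, U.BiTotal Y₁ Y₂ H s := fun s hs => hT s hs.le
  refine BackForth.mk_of_matched W (fun _ _ _ _ _ h => ⟨t, h⟩)
    (fun _ _ _ _ _ h => ⟨h.mem₁, h.mem₂⟩) (hT t le_rfl).1 (fun y hy => ?_)
    (fun g hg _ _ _ _ h₁ h₂ => ⟨eq_iff W hk hT' hg h₁ h₂, elem_iff W hk hT' hg h₁ h₂⟩) pred
  obtain ⟨n, h', hr, hm⟩ := (hT t le_rfl).2 y hy
  refine ⟨n, h', hr, fun g hg h hc => ?_⟩
  obtain ⟨x, hx⟩ := hm g.symm ⟨g, hg, rfl⟩ h (PEquiv.carries_symm.2 hc)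
  exact ⟨x, (U.matched_symm _ _ _ _ _ _).1 hx⟩

/-- By induction on the stage because of the predicates: whether `x` is `c_{t,ℓ}` is decided by
`φ_ℓ` in the preceding expanded stage, where the game is already available. -/
theorem BiTotal.backForth {t : ℕ} (hφ : ∀ ℓ, SubformulasAtMost k (U.phi ℓ))
    (hT : ∀ s ≤ t, U.BiTotal Y₁ Y₂ H s) :
    BackForth L Y₁ Y₂ H (U.stage M₁ t) (U.stage M₂ t) (U.Matched Y₁ Y₂ H t) := by
  induction t with
  | zero => exact backForth_of_pred W hk hT fun _ _ _ _ _ _ => Iff.rfl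
  | succ t ih =>
    refine backForth_of_pred W hk hT ?_
    rintro g hg x y ⟨n, h, h', hgh, hm⟩ ℓ
    have B := ih fun s hs => hT s (by omega)
    have hx := hm.mem₁
    have hy := hm.mem₂
    change (x ∈ (U.stage M₁ (t + 1)).univ ∧ _) ↔ (y ∈ (U.stage M₂ (t + 1)).univ ∧ _)
    rw [isSetOf_iff hx fun _ h => h.1, isSetOf_iff hy fun _ h => h.1]
    obtain ⟨hr, hr', ⟨i, rfl, rfl⟩ | ⟨-, -, hsx, hsy, hm⟩⟩ := hm
    · exact iff_of_false (fun h => HF.not_isSet_atom _ h.2.1)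
        fun h => HF.not_isSet_atom _ h.2.1
    · refine and_congr (iff_of_true hx hy) (and_congr (iff_of_true hsx hsy) ?_)
      exact (hT t (by omega)).forall_iff W hk hg hr hr' hgh fun g' hg' hc z w hl =>
        iff_congr (hm g' hg' hc z w hl) (BackForth.update_iff W hk B hφ hg' hl ℓ)

end

end InductiveScheme

end Matching

/-! ### Sets defined from corresponding parameters. -/

theorem Set.eq_iff_of_subset {X : Type*} {N A C : Set X} (hA : A ⊆ N) (hC : C ⊆ N) :
    A = C ↔ ∀ z : N, ((z : X) ∈ A ↔ (z : X) ∈ C) :=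
  ⟨fun h z => by rw [h], fun h => Set.ext fun z =>
    ⟨fun hz => (h ⟨z, hA hz⟩).1 hz, fun hz => (h ⟨z, hC hz⟩).2 hz⟩⟩

theorem HF.IsSetOf.eq_iff {M : Type*} {S S' : Set (HF M)} {x x' : HF M} (hx : HF.IsSetOf S x)
    (hx' : HF.IsSetOf S' x') : x = x' ↔ S = S' := by
  constructor
  · rintro rfl
    exact Set.ext fun z => (hx.2 z).symm.trans (hx'.2 z)
  · rintro rfl
    exact hx.unique hx'

section Values

variable {L : FirstOrder.Language.{u, v}} {M₁ : Type w} {M₂ : Type w'} [L.Structure M₁]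
  [L.Structure M₂] {k : ℕ} {U : InductiveScheme L} {Y₁ : SupportData M₁} {Y₂ : SupportData M₂}
  {H : Set (M₁ ≃. M₂)}

namespace InductiveScheme

variable (U) in
/-- Totality for the maps in `H` and for those of the first system, with common supports. -/
def JointTotal (Y₁ : SupportData M₁) (Y₂ : SupportData M₂) (H : Set (M₁ ≃. M₂)) (t : ℕ) : Prop :=
  ∀ x ∈ (U.stage M₁ t).univ, ∃ (n : ℕ) (h : Fin n → M₁), Set.range h ∈ Y₁.I ∧
    (∀ f ∈ Y₁.F, ∀ h', f.Carries h h' → ∃ y, U.Matched Y₁ Y₁ Y₁.F t n h h' x y) ∧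
    ∀ g ∈ H, ∀ h', g.Carries h h' → ∃ y, U.Matched Y₁ Y₂ H t n h h' x y

theorem JointTotal.total {t : ℕ} (hJ : U.JointTotal Y₁ Y₂ H t) : U.Total Y₁ Y₂ H t :=
  fun x hx => (hJ x hx).imp fun _ => Exists.imp fun _ h => ⟨h.1, h.2.2⟩

theorem JointTotal.self {t : ℕ} (hJ : U.JointTotal Y₁ Y₂ H t) : U.JointTotal Y₁ Y₁ Y₁.F t :=
  fun x hx => (hJ x hx).imp fun _ => Exists.imp fun _ h => ⟨h.1, h.2.1, h.2.1⟩

theorem JointTotal.biTotal_self {t : ℕ} (hY : IsKSystem L k Y₁) (hJ : U.JointTotal Y₁ Y₂ H t) :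
    U.BiTotal Y₁ Y₁ Y₁.F t := by
  refine ⟨hJ.self.total, ?_⟩
  rw [hY.symm_image]
  exact hJ.self.total

theorem matched_self_symm (hY : IsKSystem L k Y₁) {t n : ℕ} {h h' : Fin n → M₁} {x y : HF M₁}
    (hm : U.Matched Y₁ Y₁ Y₁.F t n h h' x y) : U.Matched Y₁ Y₁ Y₁.F t n h' h y x := by
  have := (U.matched_symm t n h h' x y).2 hm
  rwa [hY.symm_image] at this

/-- A test map `G` from `h` to `h₂` must be factored through `h₁`. For an object `a` with a joint
support `e`, both `G` and `f` are extended to `e`; the image `a₁` of `a` under the extended `f` is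
the middle object, and the inverse of the extended `f` followed by the extended `G` again belongs to
`H`. -/
theorem Matched.trans (W : IsKWitness L k Y₁ Y₂ H) (hk : 3 ≤ k) {t : ℕ}
    (hJ : ∀ s < t, U.JointTotal Y₁ Y₂ H s) (hT : ∀ s < t, U.BiTotal Y₁ Y₂ H s) {n : ℕ}
    {h h₁ : Fin n → M₁} {h₂ : Fin n → M₂} {x y : HF M₁} {z : HF M₂} {f : M₁ ≃. M₁}
    (hf : f ∈ Y₁.F) (hfc : f.Carries h h₁) (hxy : U.Matched Y₁ Y₁ Y₁.F t n h h₁ x y)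
    (hyz : U.Matched Y₁ Y₂ H t n h₁ h₂ y z) : U.Matched Y₁ Y₂ H t n h h₂ x z := by
  have hY := W.kSystem₁
  -- A tuple may repeat entries, so the two correspondences may exhibit the same urelement at
  -- different indices.
  have atoms : ∀ {i j : Fin n}, HF.atom (h₁ i) = HF.atom (h₁ j) → h i = h j := by
    intro i j hij
    have hi := hfc i
    rw [HF.atom_injective hij] at hi
    exact PEquiv.inj f hi (hfc j)
  induction t generalizing n x y z f with
  | zero =>
    obtain ⟨hr, -, i, rfl, rfl⟩ := hxy
    obtain ⟨-, hr', j, hj, rfl⟩ := hyz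
    exact ⟨hr, hr', j, by rw [atoms hj], rfl⟩
  | succ t ih =>
    obtain ⟨hr, hr₁, ⟨i, rfl, rfl⟩ | ⟨hx, -, hsx, hsy, hxy⟩⟩ := hxy
    · obtain ⟨-, hr', ⟨j, hj, rfl⟩ | ⟨-, -, hs, -⟩⟩ := hyz
      · exact ⟨hr, hr', Or.inl ⟨j, by rw [atoms hj], rfl⟩⟩
      · exact (HF.not_isSet_atom _ hs).elim
    obtain ⟨-, hr', ⟨j, rfl, -⟩ | ⟨-, hz, -, hsz, hyz⟩⟩ := hyz
    · exact (HF.not_isSet_atom _ hsy).elim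
    refine ⟨hr, hr', Or.inr ⟨hx, hz, hsx, hsz, ?_⟩⟩
    rintro G hG hGc a a₂ ⟨l, c, c₂, hcG, ha⟩
    obtain ⟨q, e, he, heF, heH⟩ := hJ t t.lt_succ_self a ha.mem₁
    obtain ⟨G', hG', e₂, hGe, hkeep⟩ := W.exists_carries (by omega) (by omega : 1 + (1 + 1) ≤ k)
      hG (union_mem_unionsOf (mem_unionsOf_one hr) (mem_unionsOf_one ha.range₁))
      (mem_unionsOf_one he)
    have hGc' := hkeep _ _ Set.subset_union_left hGc
    obtain ⟨a₂', ha₂'⟩ := heH G' hG' e₂ hGe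
    -- The given partner of `a` comes from an arbitrary support `c`; uniqueness identifies it with
    -- the partner obtained from the joint support `e`.
    obtain rfl : a₂' = a₂ := BiTotal.right_unique W hk (fun s hs => hT s (by omega)) hG'
      ⟨q, e, e₂, hGe, ha₂'⟩ ⟨l, c, c₂, hkeep _ _ Set.subset_union_right hcG, ha⟩
    obtain ⟨f', hf', e₁, hfe, hkeep'⟩ := hY.isKWitness.exists_carries (by omega)
      (by omega : 1 + 1 ≤ k) hf (mem_unionsOf_one hr) (mem_unionsOf_one he)
    have hfc' := hkeep' _ _ le_rfl hfc
    obtain ⟨a₁, ha₁⟩ := heF f' hf' e₁ hfe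
    have h₁ := hxy f' hf' hfc' a a₁ ⟨q, e, e₁, hfe, ha₁⟩
    have hf's := hY.symm_mem f' hf'
    have hinj : ∀ {i j : Fin q}, HF.atom (e i) = HF.atom (e j) → e₁ i = e₁ j := by
      intro i j hij
      have hi := hfe i
      rw [HF.atom_injective hij] at hi
      exact Option.mem_unique hi (hfe j)
    -- The induction hypothesis, applied to `e₁`, `e`, `e₂`, matches the middle object with the
    -- image of `a`.
    have h₂ := ih (fun s hs => hJ s (by omega)) (fun s hs => hT s (by omega)) hf's
      (PEquiv.carries_symm.2 hfe) (matched_self_symm hY ha₁) ha₂' hinj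
    have h₃ := hyz (f'.symm.trans G') (W.comp_left G' hG' _ hf's)
      ((PEquiv.carries_symm.2 hfc').trans hGc') a₁ a₂'
      ⟨q, e₁, e₂, (PEquiv.carries_symm.2 hfe).trans hGe, h₂⟩
    exact h₁.trans h₃

end InductiveScheme

namespace BackForth

variable {m : ℕ} {S₁ : Stage M₁ m} {S₂ : Stage M₂ m} {R : SupportedRel M₁ M₂}
  (B : BackForth L Y₁ Y₂ H S₁ S₂ R) (W : IsKWitness L k Y₁ Y₂ H)

include B W

theorem mem_definedSet_iff (hk : 0 < k) {β : Type*} {ψ : (extLang L m).Formula (Option β)}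
    (hψ : SubformulasAtMost k ψ) {g : M₁ ≃. M₂} (hg : g ∈ H) {b₁ : β → S₁.univ}
    {b₂ : β → S₂.univ} (hb : ∀ i, Linked R g (b₁ i) (b₂ i)) {z : HF M₁} {w : HF M₂}
    (hzw : Linked R g z w) : z ∈ S₁.definedSet L ψ b₁ ↔ w ∈ S₂.definedSet L ψ b₂ := by
  have hzw' := hzw
  obtain ⟨_, _, _, -, hm⟩ := hzw'
  have key : ∀ (hz : z ∈ S₁.univ) (hw : w ∈ S₂.univ),
      (S₁.Sat L ψ fun o => o.elim ⟨z, hz⟩ b₁) ↔ S₂.Sat L ψ fun o => o.elim ⟨w, hw⟩ b₂ := by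
    intro hz hw
    refine B.sat_iff W hk ψ hψ hg _ _ ?_
    rintro (_ | i)
    · exact hzw
    · exact hb i
  exact ⟨fun ⟨hz, h⟩ => ⟨B.mem₂ hm, (key hz _).1 h⟩, fun ⟨hw, h⟩ => ⟨B.mem₁ hm, (key _ hw).2 h⟩⟩

/-- Equality of the two sets is a universal statement about one object with two parameter tuples,
hence the bound `2 * r + 1`. -/
theorem definedSet_eq_iff {r : ℕ} (hr : 2 * r + 1 ≤ k)
    {ψ : (extLang L m).Formula (Option (Fin r))} (hψ : SubformulasAtMost k ψ) {g : M₁ ≃. M₂}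
    (hg : g ∈ H) {b₁ c₁ : Fin r → S₁.univ} {b₂ c₂ : Fin r → S₂.univ}
    (hb : ∀ i, Linked R g (b₁ i) (b₂ i)) (hc : ∀ i, Linked R g (c₁ i) (c₂ i)) :
    S₁.definedSet L ψ b₁ = S₁.definedSet L ψ c₁ ↔ S₂.definedSet L ψ b₂ = S₂.definedSet L ψ c₂ := by
  rw [Set.eq_iff_of_subset (fun _ h => h.1) fun _ h => h.1,
    Set.eq_iff_of_subset (fun _ h => h.1) fun _ h => h.1]
  refine B.forall_iff W (by omega) (S := (Finset.univ : Finset (Fin r ⊕ Fin r)))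
    (by simp; omega) hg (p := Sum.elim (fun i => b₁ i) fun i => c₁ i)
    (q := Sum.elim (fun i => b₂ i) fun i => c₂ i) ?_ fun g' hg' hl x y hxy => ?_
  · rintro (i | i) -
    · exact hb i
    · exact hc i
  · exact iff_congr
      (B.mem_definedSet_iff W (by omega) hψ hg' (fun i => hl (Sum.inl i) (Finset.mem_univ _)) hxy)
      (B.mem_definedSet_iff W (by omega) hψ hg' (fun i => hl (Sum.inr i) (Finset.mem_univ _)) hxy)

end BackForth

namespace InductiveScheme

variable (U) in
/-- The object `y` is the set defined by `ψ_ℓ` with the parameters that correspond to `b` when the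
joint support `h` of `b` is replaced by `h'`. -/
def Value (Y₁ : SupportData M₁) (Y₂ : SupportData M₂) (H : Set (M₁ ≃. M₂)) (t : ℕ) (ℓ : Fin U.m₀)
    {m : ℕ} {d : Fin (U.arity ℓ) → ℕ} (e : ∀ i, Fin (d i) → Fin m) (h : Fin m → M₁)
    (b : Fin (U.arity ℓ) → (U.stage M₁ t).univ) (h' : Fin m → M₂) (y : HF M₂) : Prop :=
  ∃ b' : Fin (U.arity ℓ) → (U.stage M₂ t).univ,
    (∀ i, U.Matched Y₁ Y₂ H t (d i) (h ∘ e i) (h' ∘ e i) (b i) (b' i)) ∧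
      HF.IsSetOf ((U.stage M₂ t).definedSet L (U.psi ℓ) b') y

variable {t : ℕ} {ℓ : Fin U.m₀} {m : ℕ} {d : Fin (U.arity ℓ) → ℕ} {e : ∀ i, Fin (d i) → Fin m}
  {h : Fin m → M₁} {b : Fin (U.arity ℓ) → (U.stage M₁ t).univ}

theorem Value.mem {h' : Fin m → M₂} {y : HF M₂} (hv : U.Value Y₁ Y₂ H t ℓ e h b h' y) :
    y ∈ (U.stage M₂ (t + 1)).univ := by
  obtain ⟨b', -, hy⟩ := hv
  exact U.isSetOf_mem_stage_succ M₂ hy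

theorem exists_value [Finite M₂]
    (hb : ∀ i, ∀ g ∈ H, ∀ h', g.Carries (h ∘ e i) h' →
      ∃ y, U.Matched Y₁ Y₂ H t (d i) (h ∘ e i) h' (b i) y) {g : M₁ ≃. M₂} (hg : g ∈ H)
    {h' : Fin m → M₂} (hh : g.Carries h h') : ∃ y, U.Value Y₁ Y₂ H t ℓ e h b h' y := by
  choose b' hb' using fun i => hb i g hg _ (hh.comp (e i))
  obtain ⟨y, hy⟩ := HF.exists_isSetOf ((U.finite_stage M₂ t).subset
    (definedSet_subset M₂ _ (U.psi ℓ) fun i => ⟨b' i, (hb' i).mem₂⟩))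
  exact ⟨y, _, hb', hy⟩

section

variable (W : IsKWitness L k Y₁ Y₂ H) (hk : 3 ≤ k)

include W hk

theorem Value.unique (hT : ∀ s < t, U.BiTotal Y₁ Y₂ H s) {g : M₁ ≃. M₂} (hg : g ∈ H)
    {h' : Fin m → M₂} (hh : g.Carries h h') {y y' : HF M₂}
    (hv : U.Value Y₁ Y₂ H t ℓ e h b h' y) (hv' : U.Value Y₁ Y₂ H t ℓ e h b h' y') : y = y' := by
  obtain ⟨c, hc, hy⟩ := hv
  obtain ⟨c', hc', hy'⟩ := hv'
  obtain rfl : c = c' := funext fun i => Subtype.ext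
    (BiTotal.right_unique W hk hT hg ⟨_, _, _, hh.comp (e i), hc i⟩
      ⟨_, _, _, hh.comp (e i), hc' i⟩)
  exact hy.unique hy'

/-- The parameters at `h₁` match those at `p` by composing through the original tuple `h`, and
similarly for `h₂` and `q`. For `H` equal to `ℱ₁` this is the invariance of `SameValue`; for general
`H` it recovers equality of values from membership in the image of `SameValue`. -/
theorem Value.eq_iff (hJ : ∀ s ≤ t, U.JointTotal Y₁ Y₂ H s) (hT : ∀ s ≤ t, U.BiTotal Y₁ Y₂ H s)
    (hφ : ∀ ℓ, SubformulasAtMost k (U.phi ℓ)) (hψ : SubformulasAtMost k (U.psi ℓ))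
    (hr : 2 * U.arity ℓ + 1 ≤ k) {f₁ f₂ : M₁ ≃. M₁} (hf₁ : f₁ ∈ Y₁.F) (hf₂ : f₂ ∈ Y₁.F)
    {h₁ h₂ : Fin m → M₁} (hc₁ : f₁.Carries h h₁) (hc₂ : f₂.Carries h h₂) {x₁ x₂ : HF M₁}
    (hx₁ : U.Value Y₁ Y₁ Y₁.F t ℓ e h b h₁ x₁) (hx₂ : U.Value Y₁ Y₁ Y₁.F t ℓ e h b h₂ x₂)
    {g : M₁ ≃. M₂} (hg : g ∈ H) {p q : Fin m → M₂} (hp : g.Carries h₁ p) (hq : g.Carries h₂ q)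
    {y₁ y₂ : HF M₂} (hy₁ : U.Value Y₁ Y₂ H t ℓ e h b p y₁)
    (hy₂ : U.Value Y₁ Y₂ H t ℓ e h b q y₂) : x₁ = x₂ ↔ y₁ = y₂ := by
  have hY := W.kSystem₁
  have B := BiTotal.backForth W hk hφ hT
  obtain ⟨b₁, hb₁, hx₁⟩ := hx₁
  obtain ⟨b₂, hb₂, hx₂⟩ := hx₂
  obtain ⟨c₁, hbc₁, hy₁⟩ := hy₁
  obtain ⟨c₂, hbc₂, hy₂⟩ := hy₂
  rw [hx₁.eq_iff hx₂, hy₁.eq_iff hy₂]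
  have hJ' : ∀ s < t, U.JointTotal Y₁ Y₂ H s := fun s hs => hJ s hs.le
  have hT' : ∀ s < t, U.BiTotal Y₁ Y₂ H s := fun s hs => hT s hs.le
  refine B.definedSet_eq_iff W hr hψ hg (fun i => ?_) fun i => ?_
  · exact ⟨_, _, _, hp.comp (e i), Matched.trans W hk hJ' hT' (hY.symm_mem _ hf₁)
      (PEquiv.carries_symm.2 (hc₁.comp (e i))) (matched_self_symm hY (hb₁ i)) (hbc₁ i)⟩
  · exact ⟨_, _, _, hq.comp (e i), Matched.trans W hk hJ' hT' (hY.symm_mem _ hf₂)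
      (PEquiv.carries_symm.2 (hc₂.comp (e i))) (matched_self_symm hY (hb₂ i)) (hbc₂ i)⟩

/-- If the value at a tuple is determined by the restriction of the tuple along `ρ`, then the
restriction of `h` is a support. -/
theorem exists_matched_of_value_determined [Finite M₂] {s : ℕ} (hs : s + 2 ≤ k)
    (hT : ∀ s ≤ t, U.BiTotal Y₁ Y₂ H s)
    (hφ : ∀ ℓ, SubformulasAtMost k (U.phi ℓ)) (hψ : SubformulasAtMost k (U.psi ℓ))
    (hb : ∀ i, ∀ g ∈ H, ∀ h', g.Carries (h ∘ e i) h' →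
      ∃ y, U.Matched Y₁ Y₂ H t (d i) (h ∘ e i) h' (b i) y)
    (hh : Set.range h ∈ unionsOf Y₁.I s) {x : HF M₁}
    (hx : HF.IsSetOf ((U.stage M₁ t).definedSet L (U.psi ℓ) b) x) {n : ℕ} {ρ : Fin n → Fin m}
    (hρ : Set.range (h ∘ ρ) ∈ Y₁.I)
    (hρ' : ∀ g ∈ H, ∀ h', g.Carries h h' → Set.range (h' ∘ ρ) ∈ Y₂.I)
    (hdet : ∀ g ∈ H, ∀ g' ∈ H, ∀ h' h'', g.Carries h h' → g'.Carries h h'' → h' ∘ ρ = h'' ∘ ρ →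
      ∀ y y', U.Value Y₁ Y₂ H t ℓ e h b h' y → U.Value Y₁ Y₂ H t ℓ e h b h'' y' → y = y')
    {g : M₁ ≃. M₂} (hg : g ∈ H) {c : Fin n → M₂} (hgc : g.Carries (h ∘ ρ) c) :
    ∃ y, U.Matched Y₁ Y₂ H (t + 1) n (h ∘ ρ) c x y := by
  have B := BiTotal.backForth W hk hφ hT
  -- The map `g` is known only on the restricted tuple; it is extended to all of `h` so that the
  -- parameters can be transported and define a candidate `y`.
  obtain ⟨g', hg', h', hgh, hkeep⟩ := W.exists_carries (by omega) (by omega : s + 1 ≤ k) hg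
    (mem_unionsOf_one hρ) hh
  obtain rfl : h' ∘ ρ = c := (hgh.comp ρ).ext (hkeep _ _ le_rfl hgc)
  obtain ⟨y, hy⟩ := exists_value hb hg' hgh
  refine ⟨y, hρ, hρ' g' hg' h' hgh, Or.inr ⟨U.isSetOf_mem_stage_succ M₁ hx, hy.mem, hx.1,
    hy.choose_spec.2.1, ?_⟩⟩
  rintro g₁ hg₁ hgc₁ z w ⟨l, a, a', haa', hm⟩
  obtain ⟨g₂, hg₂, h'', hgh'', hkeep₂⟩ := W.exists_carries (by omega)
    (by omega : s + (1 + 1) ≤ k) hg₁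
    (union_mem_unionsOf (mem_unionsOf_one hρ) (mem_unionsOf_one hm.range₁)) hh
  obtain ⟨y'', hy''⟩ := exists_value hb hg₂ hgh''
  have heq : h' ∘ ρ = h'' ∘ ρ := (hkeep₂ _ _ Set.subset_union_left hgc₁).ext (hgh''.comp ρ)
  obtain rfl := hdet g' hg' g₂ hg₂ h' h'' hgh hgh'' heq y y'' hy hy''
  obtain ⟨b', hb', hy''⟩ := hy''
  rw [hx.2, hy''.2]
  exact B.mem_definedSet_iff W (by omega) hψ hg₂ (fun i => ⟨_, _, _, hgh''.comp (e i), hb' i⟩)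
    ⟨l, a, a', hkeep₂ _ _ Set.subset_union_right haa', hm⟩

end

end InductiveScheme

end Values

/-! ### Existence of supports from the dichotomy, and agreement of the stages. -/

section Stages

variable {L : FirstOrder.Language.{u, v}} {M₁ : Type w} {M₂ : Type w'} [L.Structure M₁]
  [L.Structure M₂] {k s : ℕ} {U : InductiveScheme L} {Y₁ : SupportData M₁} {Y₂ : SupportData M₂}
  {H : Set (M₁ ≃. M₂)} {T₁ T₂ : ℕ → ℕ∞}

namespace InductiveScheme

variable {t : ℕ} {ℓ : Fin U.m₀} {m : ℕ} {d : Fin (U.arity ℓ) → ℕ} {e : ∀ i, Fin (d i) → Fin m}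
  {h : Fin m → M₁} {b : Fin (U.arity ℓ) → (U.stage M₁ t).univ}

variable (U) in
/-- Tuples in the orbit of `h` are identified if the corresponding values are equal. -/
def SameValue (Y : SupportData M₁) (t : ℕ) (ℓ : Fin U.m₀) {m : ℕ} {d : Fin (U.arity ℓ) → ℕ}
    (e : ∀ i, Fin (d i) → Fin m) (h : Fin m → M₁) (b : Fin (U.arity ℓ) → (U.stage M₁ t).univ)
    (h₁ h₂ : Fin m → M₁) : Prop :=
  h₁ ∈ Y.orbit h ∧ h₂ ∈ Y.orbit h ∧
    ∃ x, U.Value Y Y Y.F t ℓ e h b h₁ x ∧ U.Value Y Y Y.F t ℓ e h b h₂ x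

theorem sameValue_iff (hY : IsKSystem L k Y₁) (hk : 3 ≤ k)
    (hT : ∀ s < t, U.BiTotal Y₁ Y₁ Y₁.F s) {h₁ h₂ : Fin m → M₁} (hh₁ : h₁ ∈ Y₁.orbit h)
    (hh₂ : h₂ ∈ Y₁.orbit h) {x₁ x₂ : HF M₁} (hx₁ : U.Value Y₁ Y₁ Y₁.F t ℓ e h b h₁ x₁)
    (hx₂ : U.Value Y₁ Y₁ Y₁.F t ℓ e h b h₂ x₂) :
    U.SameValue Y₁ t ℓ e h b h₁ h₂ ↔ x₁ = x₂ := by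
  constructor
  · rintro ⟨⟨f₁, hf₁, hc₁⟩, ⟨f₂, hf₂, hc₂⟩, x, hx, hx'⟩
    rw [Value.unique hY.isKWitness hk hT hf₁ hc₁ hx₁ hx,
      Value.unique hY.isKWitness hk hT hf₂ hc₂ hx₂ hx']
  · rintro rfl
    exact ⟨hh₁, hh₂, x₁, hx₁, hx₂⟩

theorem isInvEquiv_sameValue [Finite M₁] (hY : IsKSystem L k Y₁) (hk : 3 ≤ k)
    (hJ : ∀ s ≤ t, U.JointTotal Y₁ Y₁ Y₁.F s) (hφ : ∀ ℓ, SubformulasAtMost k (U.phi ℓ))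
    (hψ : SubformulasAtMost k (U.psi ℓ)) (hr : 2 * U.arity ℓ + 1 ≤ k)
    (hb : ∀ i, ∀ g ∈ Y₁.F, ∀ h', g.Carries (h ∘ e i) h' →
      ∃ y, U.Matched Y₁ Y₁ Y₁.F t (d i) (h ∘ e i) h' (b i) y) :
    Y₁.IsInvEquiv h (U.SameValue Y₁ t ℓ e h b) := by
  have hT : ∀ s ≤ t, U.BiTotal Y₁ Y₁ Y₁.F s := fun s hs => (hJ s hs).biTotal_self hY
  have hT' : ∀ s < t, U.BiTotal Y₁ Y₁ Y₁.F s := fun s hs => hT s hs.le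
  have val : ∀ h₁ ∈ Y₁.orbit h, ∃ x, U.Value Y₁ Y₁ Y₁.F t ℓ e h b h₁ x := by
    rintro h₁ ⟨f, hf, hc⟩
    exact exists_value hb hf hc
  refine ⟨fun _ _ h => ⟨h.1, h.2.1⟩, fun h₁ hh₁ => ?_, ?_, ?_, ?_⟩
  · obtain ⟨x, hx⟩ := val h₁ hh₁
    exact ⟨hh₁, hh₁, x, hx, hx⟩
  · rintro h₁ h₂ ⟨hh₁, hh₂, x, hx₁, hx₂⟩
    exact ⟨hh₂, hh₁, x, hx₂, hx₁⟩
  · rintro h₁ h₂ h₃ ⟨hh₁, hh₂, x, hx₁, hx₂⟩ ⟨-, hh₃, x', hx₂', hx₃⟩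
    obtain ⟨f, hf, hc⟩ := hh₂
    obtain rfl := Value.unique hY.isKWitness hk hT' hf hc hx₂ hx₂'
    exact ⟨hh₁, hh₃, x, hx₁, hx₃⟩
  · intro h₁ hh₁ h₂ hh₂ h₃ hh₃ h₄ hh₄ f hf hc₁ hc₂
    obtain ⟨x₁, hx₁⟩ := val h₁ hh₁
    obtain ⟨x₂, hx₂⟩ := val h₂ hh₂
    obtain ⟨x₃, hx₃⟩ := val h₃ hh₃
    obtain ⟨x₄, hx₄⟩ := val h₄ hh₄
    rw [sameValue_iff hY hk hT' hh₁ hh₂ hx₁ hx₂, sameValue_iff hY hk hT' hh₃ hh₄ hx₃ hx₄]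
    obtain ⟨f₁, hf₁, hf₁c⟩ := hh₁
    obtain ⟨f₂, hf₂, hf₂c⟩ := hh₂
    exact Value.eq_iff hY.isKWitness hk hJ hT hφ hψ hr hf₁ hf₂ hf₁c hf₂c hx₁ hx₂ hf hc₁ hc₂ hx₃ hx₄

/-- A class is determined by its common value, and the values are objects of `N_{t+1}`. -/
theorem encard_classes_le [Finite M₁] (hY : IsKSystem L k Y₁) (hk : 3 ≤ k)
    (hT : ∀ s < t, U.BiTotal Y₁ Y₁ Y₁.F s)
    (hb : ∀ i, ∀ g ∈ Y₁.F, ∀ h', g.Carries (h ∘ e i) h' →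
      ∃ y, U.Matched Y₁ Y₁ Y₁.F t (d i) (h ∘ e i) h' (b i) y) :
    ((fun h₁ => {h₂ | U.SameValue Y₁ t ℓ e h b h₁ h₂}) '' Y₁.orbit h).encard ≤
      (U.stage M₁ (t + 1)).univ.encard := by
  have val : ∀ h₁ ∈ Y₁.orbit h, ∃ x, U.Value Y₁ Y₁ Y₁.F t ℓ e h b h₁ x := by
    rintro h₁ ⟨f, hf, hc⟩
    exact exists_value hb hf hc
  have sub : (fun h₁ => {h₂ | U.SameValue Y₁ t ℓ e h b h₁ h₂}) '' Y₁.orbit h ⊆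
      (fun x => {h₂ | h₂ ∈ Y₁.orbit h ∧ U.Value Y₁ Y₁ Y₁.F t ℓ e h b h₂ x}) ''
        (U.stage M₁ (t + 1)).univ := by
    rintro _ ⟨h₁, hh₁, rfl⟩
    obtain ⟨x, hx⟩ := val h₁ hh₁
    refine ⟨x, hx.mem, Set.ext fun h₂ => ⟨fun ⟨hh₂, hx₂⟩ => ⟨hh₁, hh₂, x, hx, hx₂⟩, ?_⟩⟩
    rintro ⟨⟨f, hf, hc⟩, hh₂, x', hx', hx₂⟩
    obtain rfl := Value.unique hY.isKWitness hk hT hf hc hx hx'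
    exact ⟨hh₂, hx₂⟩
  exact (Set.encard_le_encard sub).trans (Set.encard_image_le _ _)

/-- The heart of the induction: the dichotomy, applied to `SameValue`, shrinks the joint support of
the parameters to a support in `I` of the defined set. -/
theorem JointTotal.of_value [Finite M₁] [Finite M₂] (W : IsKWitness L k Y₁ Y₂ H) (hk : 3 ≤ k)
    (hsk : 3 * s ≤ k) (hP : PreservesDichotomy T₁ T₂ s Y₁ Y₂ H)
    (hJ : ∀ s ≤ t, U.JointTotal Y₁ Y₂ H s) (hT : ∀ s ≤ t, U.BiTotal Y₁ Y₂ H s)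
    (hφ : ∀ ℓ, SubformulasAtMost k (U.phi ℓ)) (hψ : SubformulasAtMost k (U.psi ℓ))
    (hr : U.arity ℓ ≤ s) (hO : ¬ U.OutOfTime M₁ T₁ t) (hh : Set.range h ∈ unionsOf Y₁.I s)
    (hbF : ∀ i, ∀ g ∈ Y₁.F, ∀ h', g.Carries (h ∘ e i) h' →
      ∃ y, U.Matched Y₁ Y₁ Y₁.F t (d i) (h ∘ e i) h' (b i) y)
    (hbH : ∀ i, ∀ g ∈ H, ∀ h', g.Carries (h ∘ e i) h' →
      ∃ y, U.Matched Y₁ Y₂ H t (d i) (h ∘ e i) h' (b i) y) {x : HF M₁}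
    (hx : HF.IsSetOf ((U.stage M₁ t).definedSet L (U.psi ℓ) b) x) :
    ∃ (n : ℕ) (c : Fin n → M₁), Set.range c ∈ Y₁.I ∧
      (∀ f ∈ Y₁.F, ∀ c', f.Carries c c' → ∃ y, U.Matched Y₁ Y₁ Y₁.F (t + 1) n c c' x y) ∧
      ∀ g ∈ H, ∀ c', g.Carries c c' → ∃ y, U.Matched Y₁ Y₂ H (t + 1) n c c' x y := by
  have hY := W.kSystem₁
  have hJF : ∀ s ≤ t, U.JointTotal Y₁ Y₁ Y₁.F s := fun s hs => (hJ s hs).self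
  have hTF : ∀ s ≤ t, U.BiTotal Y₁ Y₁ Y₁.F s := fun s hs => (hJ s hs).biTotal_self hY
  have hTF' : ∀ s < t, U.BiTotal Y₁ Y₁ Y₁.F s := fun s hs => hTF s hs.le
  have hE := isInvEquiv_sameValue hY hk hJF hφ hψ (by omega) hbF
  obtain ⟨g, hg⟩ := W.nonempty
  obtain ⟨g₀, hg₀, h₀, hgh₀, -⟩ := W.exists_carries (by omega) (by omega : s + 0 ≤ k) hg
    empty_mem_unionsOf_zero hh
  -- The images of `h` under all maps in `H` lie in one orbit: since `E` relates `h` to itself, its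
  -- image relates `h'` to itself, and that image is a relation on the orbit of `h₀`.
  have hmem : ∀ g ∈ H, ∀ h', g.Carries h h' → h' ∈ Y₂.orbit h₀ := by
    intro g hg h' hgh
    obtain ⟨f, hf⟩ := hY.nonempty
    obtain ⟨f', hf', h₁, hc, -⟩ := hY.isKWitness.exists_carries (by omega)
      (by omega : s + 0 ≤ k) hf empty_mem_unionsOf_zero hh
    have hself : h ∈ Y₁.orbit h := ⟨f'.trans f'.symm, hY.trans_mem _ hf' _ (hY.symm_mem _ hf'),
      hc.trans (PEquiv.carries_symm.2 hc)⟩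
    exact ((hP g₀ hg₀ m h h₀ _ hgh₀ hh hE).1.mem h' h'
      ⟨g, hg, h, h, hE.refl h hself, hgh, hgh⟩).1
  obtain ⟨-, ⟨u, ⟨hu₁, hs₁⟩, hu₂, hs₂⟩ | ⟨hmany, -⟩⟩ := hP g₀ hg₀ m h h₀ _ hgh₀ hh hE
  swap
  -- Many classes would make `N_{t+1}` alone exceed the time bound.
  · refine (hO ?_).elim
    exact (hmany.trans_le (encard_classes_le hY hk hTF' hbF)).trans_le le_self_add
  obtain ⟨n, ρ, hρ⟩ : ∃ (n : ℕ) (ρ : Fin n → Fin m), Set.range ρ = u := by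
    obtain ⟨n, ⟨eq⟩⟩ := Finite.exists_equiv_fin u
    exact ⟨n, fun i => eq.symm i, by
      rw [← Function.comp_def, Set.range_comp, eq.symm.range_eq_univ, Set.image_univ,
        Subtype.range_coe]⟩
  subst hρ
  rw [← Set.range_comp] at hu₁ hu₂
  refine ⟨n, h ∘ ρ, hu₁, fun f hf c hc => ?_, fun g hg c hc => ?_⟩
  · refine exists_matched_of_value_determined hY.isKWitness hk (by omega : s + 2 ≤ k) hTF hφ hψ
      hbF hh hx hu₁ (fun f hf h' hfc => hY.range_mem hf (hfc.comp ρ) hu₁) ?_ hf hc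
    intro f₁ hf₁ f₂ hf₂ h₁ h₂ hc₁ hc₂ heq y₁ y₂ hy₁ hy₂
    have hE₁₂ := hs₁ h₁ ⟨f₁, hf₁, hc₁⟩ h₂ ⟨f₂, hf₂, hc₂⟩ (Set.eqOn_range.2 heq)
    exact (sameValue_iff hY hk hTF' ⟨f₁, hf₁, hc₁⟩ ⟨f₂, hf₂, hc₂⟩ hy₁ hy₂).1 hE₁₂
  · refine exists_matched_of_value_determined W hk (by omega : s + 2 ≤ k) hT hφ hψ
      hbH hh hx hu₁ (fun g hg h' hgc => ?_) ?_ hg hc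
    · obtain ⟨f, hf, hfc⟩ := hmem g hg h' hgc
      exact W.kSystem₂.range_mem hf (hfc.comp ρ) hu₂
    · intro g₁ hg₁ g₂ hg₂ h₁ h₂ hc₁ hc₂ heq y₁ y₂ hy₁ hy₂
      -- The second system gives only that `h₁` and `h₂` are related by the image of `E`, that is,
      -- come along some `g₃` from tuples with equal values; `Value.eq_iff` carries this equality
      -- over.
      obtain ⟨g₃, hg₃, p, q, ⟨⟨f₁, hf₁, hp⟩, ⟨f₂, hf₂, hq⟩, z, hz₁, hz₂⟩, hpc, hqc⟩ :=
        hs₂ h₁ (hmem g₁ hg₁ h₁ hc₁) h₂ (hmem g₂ hg₂ h₂ hc₂) (Set.eqOn_range.2 heq)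
      exact (Value.eq_iff W hk hJ hT hφ hψ (by omega) hf₁ hf₂ hp hq hz₁ hz₂ hg₃ hpc hqc hy₁ hy₂).1
        rfl

theorem JointTotal.succ [Finite M₁] [Finite M₂] (W : IsKWitness L k Y₁ Y₂ H)
    (hU : U.NotTooComplicated k s) (hP : PreservesDichotomy T₁ T₂ s Y₁ Y₂ H)
    (hJ : ∀ s ≤ t, U.JointTotal Y₁ Y₂ H s) (hT : ∀ s ≤ t, U.BiTotal Y₁ Y₂ H s)
    (hO : ¬ U.OutOfTime M₁ T₁ t) : U.JointTotal Y₁ Y₂ H (t + 1) := by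
  have hk := hU.three_le
  have hY := W.kSystem₁
  rintro x (hx | hx)
  · obtain ⟨n, h, hr, hF, hH⟩ := hJ t le_rfl x hx
    refine ⟨n, h, hr, fun f hf h' hc => ?_, fun g hg h' hc => ?_⟩
    · obtain ⟨y, hy⟩ := hF f hf h' hc
      exact ⟨y, BiTotal.matched_succ hY.isKWitness hk
        (fun s hs => (hJ s hs.le).biTotal_self hY) _ _ _ _ _ hy⟩
    · obtain ⟨y, hy⟩ := hH g hg h' hc
      exact ⟨y, BiTotal.matched_succ W hk (fun s hs => hT s hs.le) _ _ _ _ _ hy⟩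
  · obtain ⟨ℓ, b, hb⟩ := Set.mem_iUnion.1 hx
    choose d h hr hF hH using fun i => hJ t le_rfl (b i) (b i).2
    -- The supports of the parameters are concatenated into one tuple indexed by `Fin m`; its range
    -- is a union of at most `s` members of `I`.
    obtain ⟨m, ⟨eq⟩⟩ := Finite.exists_equiv_fin (Σ i, Fin (d i))
    have hcomp : ∀ i, ((fun j => h (eq.symm j).1 (eq.symm j).2) ∘ fun j => eq ⟨i, j⟩) = h i :=
      fun i => funext fun j => congrArg (fun p : Σ i, Fin (d i) => h p.1 p.2)
        (eq.symm_apply_apply ⟨i, j⟩)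
    refine JointTotal.of_value (h := fun j => h (eq.symm j).1 (eq.symm j).2)
      (e := fun i j => eq ⟨i, j⟩) (b := b) W hk hU.three_mul_le hP hJ hT hU.phi_vars
      (hU.psi_vars ℓ) (hU.arity_le ℓ) hO ?_ (fun i => ?_) (fun i => ?_) hb
    · refine unionsOf_subset hY.subset_mem (biUnion_mem_unionsOf (hY.empty_mem (by omega))
        Finset.univ (by simpa using hU.arity_le ℓ) fun i _ => hr i) ?_
      rintro _ ⟨j, rfl⟩
      exact Set.mem_biUnion (Finset.mem_coe.2 (Finset.mem_univ (eq.symm j).1)) ⟨_, rfl⟩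
    · rw [hcomp i]
      exact hF i
    · rw [hcomp i]
      exact hH i

theorem JointTotal.zero (hY₁ : IsKSystem L k Y₁) (hY₂ : IsKSystem L k Y₂) :
    U.JointTotal Y₁ Y₂ H 0 := by
  rintro _ ⟨a, rfl⟩
  refine ⟨1, fun _ => a, ?_, fun f _ c _ => ⟨HF.atom (c 0), ?_⟩, fun g _ c _ =>
    ⟨HF.atom (c 0), ?_⟩⟩
  · rw [Set.range_const]
    exact hY₁.singleton_mem a
  · refine Matched.atom U 0 (h := fun _ => a) ?_ ?_ 0
    · rw [Set.range_const]
      exact hY₁.singleton_mem a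
    · rw [Set.range_unique]
      exact hY₁.singleton_mem _
  · refine Matched.atom U 0 (h := fun _ => a) ?_ ?_ 0
    · rw [Set.range_const]
      exact hY₁.singleton_mem a
    · rw [Set.range_unique]
      exact hY₂.singleton_mem _

/-- Both directions are proved in one induction, since each step uses totality both ways at all
earlier stages. -/
theorem IsWitness.jointTotal [Finite M₁] [Finite M₂] (hH : IsWitness L T₁ T₂ k s Y₁ Y₂ H)
    (hU : U.NotTooComplicated k s) (t : ℕ) (hO₁ : ∀ n < t, ¬ U.OutOfTime M₁ T₁ n)
    (hO₂ : ∀ n < t, ¬ U.OutOfTime M₂ T₂ n) : ∀ n ≤ t,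
      U.JointTotal Y₁ Y₂ H n ∧ U.JointTotal Y₂ Y₁ (PEquiv.symm '' H) n := by
  have W := hH.kWitness
  induction t with
  | zero =>
    intro n hn
    obtain rfl : n = 0 := by omega
    exact ⟨.zero W.kSystem₁ W.kSystem₂, .zero W.kSystem₂ W.kSystem₁⟩
  | succ t ih =>
    have ih := ih (fun n hn => hO₁ n (by omega)) fun n hn => hO₂ n (by omega)
    have hT : ∀ n ≤ t, U.BiTotal Y₁ Y₂ H n := fun n hn => ⟨(ih n hn).1.total, (ih n hn).2.total⟩
    intro n hn
    obtain hn | rfl := Nat.le_succ_iff.1 hn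
    · exact ih n hn
    · exact ⟨.succ W hU hH.preserves (fun n hn => (ih n hn).1) hT (hO₁ t (by omega)),
        .succ W.symm hU hH.preserves_symm (fun n hn => (ih n hn).2) (fun n hn => (hT n hn).symm)
          (hO₂ t (by omega))⟩

theorem IsWitness.biTotal [Finite M₁] [Finite M₂] (hH : IsWitness L T₁ T₂ k s Y₁ Y₂ H)
    (hU : U.NotTooComplicated k s) {t : ℕ} (hO₁ : ∀ n < t, ¬ U.OutOfTime M₁ T₁ n)
    (hO₂ : ∀ n < t, ¬ U.OutOfTime M₂ T₂ n) : ∀ n ≤ t, U.BiTotal Y₁ Y₂ H n := fun n hn =>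
  have := jointTotal hH hU t hO₁ hO₂ n hn
  ⟨this.1.total, this.2.total⟩

/-- The well-defined stages satisfy the same sentences. -/
theorem IsWitness.stageSat_iff [Finite M₁] [Finite M₂] (hH : IsWitness L T₁ T₂ k s Y₁ Y₂ H)
    (hU : U.NotTooComplicated k s) {t : ℕ∞} (hO₁ : U.StageDefined M₁ T₁ t)
    (hO₂ : U.StageDefined M₂ T₂ t) {χ : (extLang L 0).Sentence} (hχ : SubformulasAtMost k χ) :
    U.StageSat M₁ t χ ↔ U.StageSat M₂ t χ := by
  have W := hH.kWitness
  have hk := hU.three_le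
  have hT : ∀ n : ℕ, (n : ℕ∞) ≤ t → U.BiTotal Y₁ Y₂ H n := fun n hn =>
    biTotal hH hU (fun i hi => hO₁ i ((Nat.cast_lt.2 hi).trans_le hn))
      (fun i hi => hO₂ i ((Nat.cast_lt.2 hi).trans_le hn)) n le_rfl
  have hT' : ∀ n : ℕ, (n : ℕ∞) ≤ t → ∀ i < n, U.BiTotal Y₁ Y₂ H i := fun n hn i hi =>
    hT i ((Nat.cast_le.2 hi.le).trans hn)
  -- Allowing any finite level up to `t` also covers `t = ∞`; by monotonicity two linked pairs can
  -- always be compared at a common level.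
  let R : SupportedRel M₁ M₂ := fun n h h' x y =>
    ∃ i : ℕ, (i : ℕ∞) ≤ t ∧ U.Matched Y₁ Y₂ H i n h h' x y
  have common : ∀ {g : M₁ ≃. M₂} {x y z w}, Linked R g x y → Linked R g z w →
      ∃ i : ℕ, (i : ℕ∞) ≤ t ∧ Linked (U.Matched Y₁ Y₂ H i) g x y ∧
        Linked (U.Matched Y₁ Y₂ H i) g z w := by
    rintro g x y z w ⟨n, h, h', hc, i, hi, hm⟩ ⟨n', c, c', hc', j, hj, hm'⟩
    have hij : ((max i j : ℕ) : ℕ∞) ≤ t := by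
      rcases max_choice i j with h | h <;> rw [h] <;> assumption
    exact ⟨max i j, hij,
      ⟨n, h, h', hc, BiTotal.matched_mono W hk (le_max_left i j) (hT' _ hij) hm⟩,
      ⟨n', c, c', hc', BiTotal.matched_mono W hk (le_max_right i j) (hT' _ hij) hm'⟩⟩
  have B : BackForth L Y₁ Y₂ H (Stage.mk (m := 0) (U.carrier M₁ t) fun i => i.elim0)
      (Stage.mk (m := 0) (U.carrier M₂ t) fun i => i.elim0) R := by
    refine BackForth.mk_of_matched W (fun n h h' x y ⟨i, _, hm⟩ => ⟨i, hm⟩) ?_ ?_ ?_ ?_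
      fun _ _ _ _ _ i => i.elim0
    · rintro n h h' x y ⟨i, hi, hm⟩
      exact ⟨Set.mem_iUnion₂.2 ⟨i, hi, hm.mem₁⟩, Set.mem_iUnion₂.2 ⟨i, hi, hm.mem₂⟩⟩
    · intro x hx
      obtain ⟨i, hi, hx⟩ := Set.mem_iUnion₂.1 hx
      obtain ⟨n, h, hr, hm⟩ := (hT i hi).1 x hx
      exact ⟨n, h, hr, fun g hg h' hc => (hm g hg h' hc).imp fun y hy => ⟨i, hi, hy⟩⟩
    · intro y hy
      obtain ⟨i, hi, hy⟩ := Set.mem_iUnion₂.1 hy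
      obtain ⟨n, h', hr, hm⟩ := (hT i hi).2 y hy
      exact ⟨n, h', hr, fun g hg h hc => (hm g.symm ⟨g, hg, rfl⟩ h (PEquiv.carries_symm.2 hc)).imp
        fun x hx => ⟨i, hi, (U.matched_symm _ _ _ _ _ _).1 hx⟩⟩
    · intro g hg x y z w hxy hzw
      obtain ⟨i, hi, h₁, h₂⟩ := common hxy hzw
      exact ⟨BiTotal.eq_iff W hk (hT' i hi) hg h₁ h₂, BiTotal.elem_iff W hk (hT' i hi) hg h₁ h₂⟩
  obtain ⟨g, hg⟩ := W.nonempty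
  exact B.sat_iff W (by omega) χ hχ hg _ _ fun z => z.elim

/-- At a well-defined stage, the two computations halt simultaneously. -/
theorem IsWitness.halts_iff [Finite M₁] [Finite M₂] (hH : IsWitness L T₁ T₂ k s Y₁ Y₂ H)
    (hU : U.NotTooComplicated k s) {t : ℕ} (hO₁ : ∀ n < t, ¬ U.OutOfTime M₁ T₁ n)
    (hO₂ : ∀ n < t, ¬ U.OutOfTime M₂ T₂ n) : U.Halts M₁ t ↔ U.Halts M₂ t := by
  have W := hH.kWitness
  have hk := hU.three_le
  have B := BiTotal.backForth W hk hU.phi_vars (biTotal hH hU hO₁ hO₂)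
  obtain ⟨g, hg⟩ := W.nonempty
  refine exists_congr fun h => ?_
  rw [Set.eq_iff_of_subset (N := (U.stage M₁ t).univ) (fun _ h => h.1) fun _ h => h.1,
    Set.eq_iff_of_subset (N := (U.stage M₂ t).univ) (fun _ h => h.1) fun _ h => h.1]
  refine B.forall_iff W (by omega) (S := (∅ : Finset Empty)) (by simp; omega) hg
    (p := Empty.elim) (q := Empty.elim) (by simp) fun g' hg' _ x y hxy => ?_
  exact iff_congr (BackForth.update_iff W hk B hU.phi_vars hg' hxy _)
    (BackForth.update_iff W hk B hU.phi_vars hg' hxy _)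

/-! ### Stopping times and truth values. -/

section StopTime

variable (U) {M : Type w} [L.Structure M] {T : ℕ → ℕ∞}

theorem stopTime_eq_top_or_coe : U.stopTime M T = ⊤ ∨ ∃ n : ℕ, U.stopTime M T = n ∧
    (U.OutOfTime M T n ∨ U.Halts M n) := by
  rcases Set.eq_empty_or_nonempty
    {t : ℕ∞ | ∃ n : ℕ, t = n ∧ (U.OutOfTime M T n ∨ U.Halts M n)} with h | h
  · left
    rw [stopTime, h, sInf_empty]
  · exact Or.inr (csInf_mem h)

theorem not_of_lt_stopTime {n : ℕ} (hn : (n : ℕ∞) < U.stopTime M T) :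
    ¬ U.OutOfTime M T n ∧ ¬ U.Halts M n := by
  rw [← not_or]
  exact fun h => hn.not_ge (sInf_le ⟨n, rfl, h⟩)

theorem truthValue_of_stopTime_eq {n : ℕ} (hn : U.stopTime M T = n)
    (χ : (extLang L 0).Sentence) [Decidable (U.Halts M n)] :
    U.truthValue M χ T = if U.Halts M n then some (U.StageSat M n χ) else none := by
  simp [truthValue, hn]

theorem truthValue_of_stopTime_eq_top (hn : U.stopTime M T = ⊤) (χ : (extLang L 0).Sentence) :
    U.truthValue M χ T = none := by
  simp [truthValue, hn]

end StopTime

/-- If the first computation stops before the second one, then it does not halt. -/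
theorem IsWitness.truthValue_eq_none [Finite M₁] [Finite M₂]
    (hH : IsWitness L T₁ T₂ k s Y₁ Y₂ H) (hU : U.NotTooComplicated k s)
    (hlt : U.stopTime M₁ T₁ < U.stopTime M₂ T₂) (χ : (extLang L 0).Sentence) :
    U.truthValue M₁ χ T₁ = none := by
  classical
  obtain h | ⟨n, hn, -⟩ := U.stopTime_eq_top_or_coe (M := M₁) (T := T₁)
  · exact U.truthValue_of_stopTime_eq_top h χ
  · rw [U.truthValue_of_stopTime_eq hn, if_neg]
    rw [hn] at hlt
    -- At time `n` the second computation has not stopped, so it does not halt there, and neither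
    -- computation was out of time earlier; non-halting therefore transfers to the first.
    rw [halts_iff hH hU (T₁ := T₁) (T₂ := T₂)]
    · exact (U.not_of_lt_stopTime hlt).2
    · exact fun i hi => (U.not_of_lt_stopTime (hn ▸ Nat.cast_lt.2 hi)).1
    · exact fun i hi => (U.not_of_lt_stopTime ((Nat.cast_lt.2 hi).trans hlt)).1

theorem IsWitness.truthValue_eq [Finite M₁] [Finite M₂]
    (hH : IsWitness L T₁ T₂ k s Y₁ Y₂ H) (hU : U.NotTooComplicated k s)
    (heq : U.stopTime M₁ T₁ = U.stopTime M₂ T₂) {χ : (extLang L 0).Sentence}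
    (hχ : SubformulasAtMost k χ) : U.truthValue M₁ χ T₁ = U.truthValue M₂ χ T₂ := by
  classical
  obtain h | ⟨n, hn, -⟩ := U.stopTime_eq_top_or_coe (M := M₁) (T := T₁)
  · rw [U.truthValue_of_stopTime_eq_top h, U.truthValue_of_stopTime_eq_top (heq ▸ h)]
  · have hn' : U.stopTime M₂ T₂ = n := heq ▸ hn
    have hO₁ : U.StageDefined M₁ T₁ n := fun i hi => (U.not_of_lt_stopTime (hn ▸ hi)).1
    have hO₂ : U.StageDefined M₂ T₂ n := fun i hi => (U.not_of_lt_stopTime (hn' ▸ hi)).1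
    rw [U.truthValue_of_stopTime_eq hn, U.truthValue_of_stopTime_eq hn',
      propext (stageSat_iff hH hU hO₁ hO₂ hχ), propext (halts_iff hH hU
        (fun i hi => hO₁ i (Nat.cast_lt.2 hi)) fun i hi => hO₂ i (Nat.cast_lt.2 hi))]

end InductiveScheme

theorem IsWitness.symm (hH : IsWitness L T₁ T₂ k s Y₁ Y₂ H) :
    IsWitness L T₂ T₁ k s Y₂ Y₁ (PEquiv.symm '' H) :=
  ⟨hH.system₂, hH.system₁, hH.kWitness.symm, hH.preserves_symm, by
    rw [InductiveScheme.symm_symm_image]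
    exact hH.preserves⟩

end Stages
theorem mainTheorem1 {L : FirstOrder.Language.{u, v}} {M₁ : Type w} {M₂ : Type w'}
    [Finite M₁] [Finite M₂] [L.Structure M₁] [L.Structure M₂]
    (T₁ T₂ : ℕ → ℕ∞) (k s : ℕ) (Y₁ : SupportData M₁) (Y₂ : SupportData M₂)
    (hY₁ : IsSystem L T₁ k s Y₁) (hY₂ : IsSystem L T₂ k s Y₂)
    (H : Set (M₁ ≃. M₂)) (hH : IsWitness L T₁ T₂ k s Y₁ Y₂ H)
    (U : InductiveScheme L) (hU : U.NotTooComplicated k s) :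
    (∀ χ : (extLang L 0).Sentence, SubformulasAtMost k χ →
      (U.truthValue M₁ χ T₁ = U.truthValue M₂ χ T₂ ∨
        (U.truthValue M₁ χ T₁ = none ∧ U.truthValue M₂ χ T₂ ≠ none ∧
          U.stopTime M₁ T₁ < U.stopTime M₂ T₂) ∨
        (U.truthValue M₂ χ T₂ = none ∧ U.truthValue M₁ χ T₁ ≠ none ∧
          U.stopTime M₂ T₂ < U.stopTime M₁ T₁))) ∧
    (∀ t : ℕ∞, U.StageDefined M₁ T₁ t → U.StageDefined M₂ T₂ t →
      ∀ χ : (extLang L 0).Sentence, SubformulasAtMost k χ →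
        (U.StageSat M₁ t χ ↔ U.StageSat M₂ t χ)) := by
  refine ⟨fun χ hχ => ?_, fun t h₁ h₂ χ hχ =>
    InductiveScheme.IsWitness.stageSat_iff hH hU h₁ h₂ hχ⟩
  rcases lt_trichotomy (U.stopTime M₁ T₁) (U.stopTime M₂ T₂) with h | h | h
  · have hnone := InductiveScheme.IsWitness.truthValue_eq_none hH hU h χ
    by_cases h' : U.truthValue M₂ χ T₂ = none
    · exact Or.inl (hnone.trans h'.symm)
    · exact Or.inr (Or.inl ⟨hnone, h', h⟩)
  · exact Or.inl (InductiveScheme.IsWitness.truthValue_eq hH hU h hχ)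
  · have hnone := InductiveScheme.IsWitness.truthValue_eq_none hH.symm hU h χ
    by_cases h' : U.truthValue M₁ χ T₁ = none
    · exact Or.inl (h'.trans hnone.symm)
    · exact Or.inr (Or.inr ⟨hnone, h', h⟩)
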